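/- **Setting.** Let $N\ge 1$, $1<p<\infty$, $p'=\frac{p}{p-1}$, $s\in(0,1)$ with $ps<N$, $c_0>0$, $\delta>0$, $0<h_{\min}<h_{\max}$. Let $\Omega\subset\mathbb R^N$ be a bounded open set and $\Omega_\delta=\Omega\cup\bigcup_{q\in\partial\Omega}B(q,\delta)$. Let $k:\mathbb R\to[0,\infty)$ be measurable with $k(r)=0$ for $r\ge\delta$, with $k(r)\ge c_0\,r^{-(N+(s-1)p)}$ for $0<r<\delta$, and with $\frac1{C_N}\int_{B(0,\delta)}k(|z|)\,dz=1$, where $C_N=\frac{1}{\mathcal H^{N-1}(S^{N-1})}\int_{S^{N-1}}|\omega\cdot e|^p\,d\mathcal H^{N-1}(\omega)$ for any unit vector $e$. Let $h:\Omega_\delta\to\mathbb R$ be measurable with $h\in[h_{\min},h_{\max}]$ a.e. in $\Omega$ and $h=0$ a.e. in $\Omega_\delta\setminus\Omega$, and put $$B_h(u,v)=\int_{\Omega_\delta}\int_{\Omega_\delta}\frac{h(x')+h(x)}2\,k(|x'-x|)\,\frac{|u(x')-u(x)|^{p-2}(u(x')-u(x))}{|x'-x|^p}\,(v(x')-v(x))\,dx'\,dx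 ;$$ let $B$ be the same form with $\frac{h(x')+h(x)}2$ replaced by $1$. Let $X=\{u\in L^p(\Omega_\delta):B(u,u)<\infty\}$ and $X_0=\{u\in X:u=0\text{ a.e. in }\Omega_\delta\setminus\Omega\}$. Let $u_0$ be the restriction to $\Omega_\delta\setminus\Omega$ of an element of $X$, and let $u_0+X_0$ denote the set of $v\in X$ with $v=u_0$ a.e. in $\Omega_\delta\setminus\Omega$. For $f\in L^{p'}(\Omega)$, a *state associated with $f$* is a $v\in u_0+X_0$ with $B_h(v,w)=\int_\Omega f\,w\,dx$ for all $w\in X_0$. **Theorem ($G$-convergence).** Let $g_j,g\in L^{p'}(\Omega)$ with $g_j\rightharpoonup g$ weakly in $L^{p'}(\Omega)$. Then the following minima are attained and $$\lim_{j\to\infty}\ \min_{w\in u_0+X_0}\Big\{\frac1pB_h(w,w)-\int_\Omega g_j\,w\,dx\Big\}=\min_{w\in u_0+X_0}\Big\{\frac1pB_h(w,w)-\int_\Omega g\,w\,dx\Big\}.$$ Moreover, if $u_j$ is the state associated with $g_j$ for each $j$, and $u$ is the state associated with $g$, then $u_j\to u$ strongly in $L^p(\Omega_\delta)$; and whenever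 a subsequence of $(u_j)$ converges strongly in $L^p(\Omega_\delta)$ to some $u^*$, then $u^*=u$ a.e. in $\Omega_\delta$. -/

import Mathlib

open MeasureTheory Filter Topology Set

namespace NonlocalDirichlet

noncomputable section

/-- `ℝ^N` with the Euclidean norm. -/
abbrev Eucl (N : ℕ) : Type := EuclideanSpace ℝ (Fin N)

/-- `Ω_δ = Ω ∪ ⋃_{q ∈ ∂Ω} B(q, δ)`. -/
def extendedDomain {N : ℕ} (Ω : Set (Eucl N)) (δ : ℝ) : Set (Eucl N) :=
  Ω ∪ ⋃ q ∈ frontier Ω, Metric.ball q δ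

/-- Lebesgue measure on `Ω_δ`. -/
def extVol {N : ℕ} (Ω : Set (Eucl N)) (δ : ℝ) : Measure (Eucl N) :=
  volume.restrict (extendedDomain Ω δ)

/-- Lebesgue measure on the collar `Ω_δ \ Ω`. -/
def collarVol {N : ℕ} (Ω : Set (Eucl N)) (δ : ℝ) : Measure (Eucl N) :=
  volume.restrict (extendedDomain Ω δ \ Ω)

/-- The mean of `|ω · e|^p` over the unit sphere with respect to the `(N-1)`-dimensional
Hausdorff measure. It does not depend on the unit vector `e`. -/
def sphereMean {N : ℕ} (p : ℝ) (e : Eucl N) : ℝ :=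
  (1 / (Measure.hausdorffMeasure ((N : ℝ) - 1) (Metric.sphere (0 : Eucl N) 1)).toReal) *
    ∫ ω in Metric.sphere (0 : Eucl N) 1, |inner ℝ ω e| ^ p
      ∂(Measure.hausdorffMeasure ((N : ℝ) - 1))

/-- The assumptions on the radial kernel `z ↦ k |z|` on `ℝ^N` with horizon `δ`. -/
structure IsKernel (N : ℕ) (p s c₀ δ : ℝ) (k : ℝ → ℝ) : Prop where
  measurable : Measurable k
  nonneg : ∀ r, 0 ≤ k r
  eq_zero : ∀ r, δ ≤ r → k r = 0
  normalized : ∀ e : Eucl N, ‖e‖ = 1 →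
    (1 / sphereMean p e) * ∫ z in Metric.ball (0 : Eucl N) δ, k ‖z‖ = 1
  lower_bound : ∀ r, 0 < r → r < δ → c₀ / r ^ ((N : ℝ) + (s - 1) * p) ≤ k r

/-- The class `𝓗` of diffusion coefficients. -/
structure IsCoefficient {N : ℕ} (Ω : Set (Eucl N)) (δ hmin hmax : ℝ) (h : Eucl N → ℝ) :
    Prop where
  aemeasurable : AEMeasurable h (extVol Ω δ)
  mem_Icc : ∀ᵐ x ∂(volume.restrict Ω), h x ∈ Icc hmin hmax
  eq_zero : ∀ᵐ x ∂(collarVol Ω δ), h x = 0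

/-- The integrand, at `z = (x, x')`, of the nonlocal form with weight `H(x', x)`. -/
def formIntegrand {N : ℕ} (p : ℝ) (k : ℝ → ℝ) (H : Eucl N → Eucl N → ℝ) (u v : Eucl N → ℝ)
    (z : Eucl N × Eucl N) : ℝ :=
  H z.2 z.1 * k ‖z.2 - z.1‖ *
    (|u z.2 - u z.1| ^ (p - 2) * (u z.2 - u z.1) / ‖z.2 - z.1‖ ^ p) * (v z.2 - v z.1)

/-- The form `B_h(u, v)`, with `H(x', x) = (h(x') + h(x)) / 2`, as an integral over
`Ω_δ × Ω_δ`. -/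
def form {N : ℕ} (Ω : Set (Eucl N)) (δ p : ℝ) (k : ℝ → ℝ) (h : Eucl N → ℝ)
    (u v : Eucl N → ℝ) : ℝ :=
  ∫ z, formIntegrand p k (fun x' x => (h x' + h x) / 2) u v z
    ∂((extVol Ω δ).prod (extVol Ω δ))

/-- The energy space `X`: functions in `L^p(Ω_δ)` with `B(u, u) < ∞`, where `B` is the form with
weight `1`. The integrand of `B(u, u)` is nonnegative, so that `B(u, u) < ∞` is integrability.
Functions are defined on `ℝ^N`, but only their classes modulo null sets of `Ω_δ` matter. -/
def energySpace {N : ℕ} (Ω : Set (Eucl N)) (δ p : ℝ) (k : ℝ → ℝ) : Set (Eucl N → ℝ) :=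
  {u | MemLp u (ENNReal.ofReal p) (extVol Ω δ) ∧
    Integrable (formIntegrand p k (fun _ _ => 1) u u) ((extVol Ω δ).prod (extVol Ω δ))}

/-- The constrained energy space `X₀`. -/
def energySpaceZero {N : ℕ} (Ω : Set (Eucl N)) (δ p : ℝ) (k : ℝ → ℝ) : Set (Eucl N → ℝ) :=
  {u | u ∈ energySpace Ω δ p k ∧ ∀ᵐ x ∂(collarVol Ω δ), u x = 0}

/-- The space of boundary data: restrictions to `Ω_δ \ Ω` of elements of `X`. -/
def traceSpace {N : ℕ} (Ω : Set (Eucl N)) (δ p : ℝ) (k : ℝ → ℝ) : Set (Eucl N → ℝ) :=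
  {u₀ | ∃ w ∈ energySpace Ω δ p k, ∀ᵐ x ∂(collarVol Ω δ), w x = u₀ x}

/-- The competitors `u₀ + X₀`: the elements `v` of `X` with `v = u₀` in `Ω_δ \ Ω`. Only the
values of `u₀` in `Ω_δ \ Ω` are used. -/
def competitors {N : ℕ} (Ω : Set (Eucl N)) (δ p : ℝ) (k : ℝ → ℝ) (u₀ : Eucl N → ℝ) :
    Set (Eucl N → ℝ) :=
  {v | v ∈ energySpace Ω δ p k ∧ ∀ᵐ x ∂(collarVol Ω δ), v x = u₀ x}

/-- The Dirichlet functional `(1/p) B_h(w, w) - ∫_Ω g w`. -/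
def dirichletFunctional {N : ℕ} (Ω : Set (Eucl N)) (δ p : ℝ) (k : ℝ → ℝ) (h g : Eucl N → ℝ)
    (w : Eucl N → ℝ) : ℝ :=
  (1 / p) * form Ω δ p k h w w - ∫ x in Ω, g x * w x

/-- `u` is the state associated with the source `g`: `u ∈ X`, `u = u₀` in `Ω_δ \ Ω`, and
`B_h(u, w) = ∫_Ω g w` for every `w ∈ X₀`. -/
def IsState {N : ℕ} (Ω : Set (Eucl N)) (δ p : ℝ) (k : ℝ → ℝ) (h u₀ g : Eucl N → ℝ)
    (u : Eucl N → ℝ) : Prop :=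
  u ∈ competitors Ω δ p k u₀ ∧
    ∀ w ∈ energySpaceZero Ω δ p k, form Ω δ p k h u w = ∫ x in Ω, g x * w x

/-- Weak convergence `g_j ⇀ g` in `L^{p'}(Ω)`, `p' = p / (p - 1)`, for functions in `L^{p'}(Ω)`:
convergence of the pairings with all elements of `L^p(Ω)`. -/
def WeaklyConverges {N : ℕ} (Ω : Set (Eucl N)) (p : ℝ) (g : ℕ → Eucl N → ℝ)
    (g' : Eucl N → ℝ) : Prop :=
  ∀ φ : Eucl N → ℝ, MemLp φ (ENNReal.ofReal p) (volume.restrict Ω) →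
    Tendsto (fun j => ∫ x in Ω, g j x * φ x) atTop (𝓝 (∫ x in Ω, g' x * φ x))

/-- Strong convergence `u_j → u` in `L^p(Ω_δ)`. -/
def StronglyConverges {N : ℕ} (Ω : Set (Eucl N)) (δ p : ℝ) (u : ℕ → Eucl N → ℝ)
    (u' : Eucl N → ℝ) : Prop :=
  Tendsto (fun j => eLpNorm (u j - u') (ENNReal.ofReal p) (extVol Ω δ)) atTop (𝓝 0)

end

end NonlocalDirichlet

namespace NonlocalDirichlet

/-! ### Pointwise inequalities for powers -/

/-! Write E(w) = B_h(w, w). Everything rests on uniform convexity of E and on one compactness fact.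

Convexity: for every ε, |a - b|^p is at most ε(|a|^p + |b|^p) plus a multiple of the midpoint
convexity gap (`exists_convexity_gap`). Integrated against the nonnegative weight, this says that
two almost-minimizers of bounded energy differ by small energy. Minimizing sequences are therefore
Cauchy in energy. A Poincaré inequality on X₀ (`exists_poincare`) makes them Cauchy in L^p, and
Fatou's lemma puts the limit in the class with no loss of energy, so minima exist without weak
compactness in X. States are minimizers because |·|^p lies above its tangents.

Compactness: if f_j ⇀ 0 in L^{p'}(Ω), then ∫ f_j w → 0 uniformly over w ∈ X₀ of bounded energy
(`eventually_abs_integral_mul_le`). This replaces the compact embedding of X₀ in L^p. Replacing w(x)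
by w(y) with |x - y| < r costs a factor r^s, by the singular lower bound on k; what remains pairs w
with the integrals of f_j over r-balls, which tend to 0 strongly for fixed r.

Hence the functionals for g_j converge to that for g uniformly on energy-bounded sets of
competitors. The minima converge, the minimizers for g_j are almost-minimizers for g, and so E(u_j -
u) → 0; Poincaré turns this into L^p convergence.

The coefficient h vanishes on the collar. This is harmless on X₀: an increment can be nonzero only
if one of its points is in Ω, and there the weight is at least hmin/2. For this reason estimates are
made on differences of competitors. -/

lemma abs_rpow_sub_two_mul_self_mul_self {p : ℝ} (hp : 1 < p) (a : ℝ) :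
    |a| ^ (p - 2) * a * a = |a| ^ p := by
  rcases eq_or_ne a 0 with rfl | ha
  · simp [Real.zero_rpow (by linarith : p ≠ 0)]
  · have h : 0 < |a| := abs_pos.2 ha
    rw [mul_assoc, ← abs_mul_abs_self a, ← mul_assoc, ← Real.rpow_add_one h.ne',
      ← Real.rpow_add_one h.ne']
    congr 1; ring

lemma abs_abs_rpow_sub_two_mul {p : ℝ} (hp : 1 < p) (a : ℝ) :
    |(|a| ^ (p - 2) * a)| = |a| ^ (p - 1) := by
  rcases eq_or_ne a 0 with rfl | ha
  · simp [Real.zero_rpow (by linarith : p - 1 ≠ 0)]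
  · have h : 0 < |a| := abs_pos.2 ha
    rw [abs_mul, abs_of_nonneg (Real.rpow_nonneg h.le _), ← Real.rpow_add_one h.ne']
    congr 1; ring

/-- Young's inequality for a^(p-1) and b with exponents p/(p-1) and p, cleared of denominators. -/
lemma mul_rpow_sub_one_mul_le {p : ℝ} (hp : 1 < p) {a b : ℝ} (ha : 0 ≤ a) (hb : 0 ≤ b) :
    p * (a ^ (p - 1) * b) ≤ (p - 1) * a ^ p + b ^ p := by
  have hp0 : 0 < p := by linarith
  have hp1 : 0 < p - 1 := by linarith
  have hc : (p / (p - 1)).HolderConjugate p := (Real.HolderConjugate.conjExponent hp).symm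
  have h := Real.young_inequality_of_nonneg (Real.rpow_nonneg ha (p - 1)) hb hc
  rw [← Real.rpow_mul ha, mul_div_cancel₀ _ hp1.ne'] at h
  calc p * (a ^ (p - 1) * b) ≤ p * (a ^ p / (p / (p - 1)) + b ^ p / p) := by gcongr
    _ = _ := by field_simp

/-- The graph of |·|^p lies above its tangent at a; once the product is expanded, this is Young's
inequality. -/
lemma rpow_abs_tangent_le {p : ℝ} (hp : 1 < p) (a b : ℝ) :
    p * (|a| ^ (p - 2) * a * (b - a)) ≤ |b| ^ p - |a| ^ p := by
  have h1 := mul_rpow_sub_one_mul_le hp (abs_nonneg a) (abs_nonneg b)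
  have h2 : |a| ^ (p - 2) * a * b ≤ |a| ^ (p - 1) * |b| := by
    rw [← abs_abs_rpow_sub_two_mul hp, ← abs_mul]; exact le_abs_self _
  have h3 := abs_rpow_sub_two_mul_self_mul_self hp a
  have h4 : p * (|a| ^ (p - 2) * a * b) ≤ p * (|a| ^ (p - 1) * |b|) := by gcongr
  rw [mul_sub, h3]
  linarith

lemma abs_sub_rpow_le {p : ℝ} (hp : 1 < p) (a b : ℝ) :
    |a - b| ^ p ≤ 2 ^ (p - 1) * (|a| ^ p + |b| ^ p) := by
  refine (Real.rpow_le_rpow (abs_nonneg _) (abs_sub a b) (by linarith)).trans ?_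
  exact_mod_cast NNReal.rpow_add_le_mul_rpow_add_rpow ⟨|a|, abs_nonneg a⟩ ⟨|b|, abs_nonneg b⟩ hp.le

/-- If |a| = |b| with a ≠ b, then b = -a and the midpoint is 0; otherwise strict convexity on [0, ∞)
applies to |a| and |b|. -/
lemma midpoint_rpow_lt {p : ℝ} (hp : 1 < p) {a b : ℝ} (hab : a ≠ b) :
    |(a + b) / 2| ^ p < (|a| ^ p + |b| ^ p) / 2 := by
  rcases eq_or_ne |a| |b| with h | h
  · rcases abs_eq_abs.1 h with h' | h'
    · exact absurd h' hab
    · subst h'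
      have hb : b ≠ 0 := by rintro rfl; simp at hab
      have : 0 < |b| ^ p := Real.rpow_pos_of_pos (abs_pos.2 hb) _
      simpa [Real.zero_rpow (by linarith : p ≠ 0)] using this
  · have h1 := (strictConvexOn_rpow hp).2 (mem_Ici.2 (abs_nonneg a)) (mem_Ici.2 (abs_nonneg b)) h
      (show (0 : ℝ) < 1 / 2 by norm_num) (show (0 : ℝ) < 1 / 2 by norm_num) (by norm_num)
    simp only [smul_eq_mul] at h1
    refine lt_of_le_of_lt (Real.rpow_le_rpow (abs_nonneg _) ?_ (by linarith)) (h1.trans_eq (by ring))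
    rw [abs_div, abs_two]
    linarith [abs_add_le a b]

/-- A quantitative form of the strict convexity of `x ↦ |x| ^ p`. -/
lemma exists_convexity_gap {p : ℝ} (hp : 1 < p) {ε : ℝ} (hε : 0 < ε) :
    ∃ C : ℝ, 0 ≤ C ∧ ∀ a b : ℝ, |a - b| ^ p ≤ ε * (|a| ^ p + |b| ^ p) +
      C * ((|a| ^ p + |b| ^ p) / 2 - |(a + b) / 2| ^ p) := by
  have hp0 : 0 < p := by linarith
  have hcont : ∀ f : ℝ × ℝ → ℝ, Continuous f → Continuous fun x => |f x| ^ p := fun f hf =>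
    hf.abs.rpow_const fun _ => Or.inr hp0.le
  have h1 := hcont (fun x => x.1) continuous_fst
  have h2 := hcont (fun x => x.2) continuous_snd
  have h3 := hcont (fun x => x.1 - x.2) (by fun_prop)
  have h4 := hcont (fun x => (x.1 + x.2) / 2) (by fun_prop)
  let G : ℝ × ℝ → ℝ := fun x => (|x.1| ^ p + |x.2| ^ p) / 2 - |(x.1 + x.2) / 2| ^ p
  have hG : Continuous G := ((h1.add h2).div_const 2).sub h4
  have hG0 : ∀ x, 0 ≤ G x := fun x => by
    rcases eq_or_ne x.1 x.2 with h | h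
    · simp [G, h]
    · exact (sub_pos.2 (midpoint_rpow_lt hp h)).le
  -- S is the compact part of the unit sphere where the ε-term alone does not suffice. There a = b
  -- would force a = b = 0, so the gap G is positive and the quotient by G is bounded.
  let S : Set (ℝ × ℝ) := Metric.sphere 0 1 ∩ {x | ε * (|x.1| ^ p + |x.2| ^ p) ≤ |x.1 - x.2| ^ p}
  have hS : IsCompact S := (isCompact_sphere _ _).inter_right
    (isClosed_le (continuous_const.mul (h1.add h2)) h3)
  have hGS : ∀ x ∈ S, G x ≠ 0 := by
    rintro x ⟨hx1, hx2⟩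
    refine (sub_pos.2 (midpoint_rpow_lt hp fun h => ?_)).ne'
    simp only [mem_ofPred_eq, h, sub_self, abs_zero, Real.zero_rpow hp0.ne'] at hx2
    have h0 : |x.2| ^ p ≤ 0 := by nlinarith
    have : x.2 = 0 := by
      by_contra hne
      exact absurd (Real.rpow_pos_of_pos (abs_pos.2 hne) p) (not_lt.2 h0)
    have hx : x = 0 := Prod.ext (h.trans this) this
    simp [hx] at hx1
  obtain ⟨C, hC⟩ := hS.exists_bound_of_continuousOn
    (f := fun x => |x.1 - x.2| ^ p / G x) (h3.continuousOn.div hG.continuousOn hGS)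
  have key : ∀ x ∈ Metric.sphere (0 : ℝ × ℝ) 1,
      |x.1 - x.2| ^ p ≤ ε * (|x.1| ^ p + |x.2| ^ p) + max C 0 * G x := by
    intro x hx
    by_cases hxS : ε * (|x.1| ^ p + |x.2| ^ p) ≤ |x.1 - x.2| ^ p
    · have hpos : 0 < G x := lt_of_le_of_ne (hG0 x) (hGS x ⟨hx, hxS⟩).symm
      have := (le_abs_self _).trans (hC x ⟨hx, hxS⟩)
      rw [div_le_iff₀ hpos] at this
      have h5 : C * G x ≤ max C 0 * G x := by gcongr; exact le_max_left _ _
      have h6 : 0 ≤ ε * (|x.1| ^ p + |x.2| ^ p) := by positivity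
      linarith
    · have := mul_nonneg (le_max_right C 0) (hG0 x)
      linarith [not_le.1 hxS]
  refine ⟨max C 0, le_max_right _ _, fun a b => ?_⟩
  rcases eq_or_ne ((a, b) : ℝ × ℝ) 0 with h0 | h0
  · obtain ⟨rfl, rfl⟩ := Prod.mk.inj h0
    simp [Real.zero_rpow hp0.ne']
  -- All terms are homogeneous of degree p, so the sphere estimate extends by scaling.
  · set t := ‖((a, b) : ℝ × ℝ)‖
    have ht : 0 < t := norm_pos_iff.2 h0
    have hsc : ∀ y : ℝ, |y| ^ p = t ^ p * |t⁻¹ * y| ^ p := fun y => by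
      rw [abs_mul, abs_of_pos (inv_pos.2 ht), Real.mul_rpow (by positivity) (abs_nonneg _),
        ← mul_assoc, ← Real.mul_rpow ht.le (by positivity), mul_inv_cancel₀ ht.ne',
        Real.one_rpow, one_mul]
    have hk := key (t⁻¹ • (a, b)) (by
      rw [mem_sphere_zero_iff_norm, norm_smul, norm_inv, Real.norm_of_nonneg ht.le]
      exact inv_mul_cancel₀ ht.ne')
    simp only [G, Prod.smul_mk, smul_eq_mul] at hk
    rw [← mul_sub, ← mul_add, mul_div_assoc] at hk
    rw [hsc (a - b), hsc a, hsc b, hsc ((a + b) / 2)]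
    have := mul_le_mul_of_nonneg_left hk (Real.rpow_nonneg ht.le p)
    refine this.trans_eq ?_
    ring

lemma exists_mul_rpow_le {p : ℝ} (hp : 1 < p) {c η : ℝ} (hc : 0 ≤ c) (hη : 0 < η) :
    ∃ C : ℝ, 0 ≤ C ∧ ∀ t : ℝ, 0 ≤ t → c * t ^ (1 / p) ≤ η * t + C := by
  have hp0 : 0 < p := by linarith
  have hq : (p / (p - 1)).HolderConjugate p := (Real.HolderConjugate.conjExponent hp).symm
  have hpη : 0 < p * η := by positivity
  refine ⟨(c / (p * η) ^ (1 / p)) ^ (p / (p - 1)) / (p / (p - 1)), ?_, fun t ht => ?_⟩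
  · have : 0 < p - 1 := by linarith
    positivity
  -- The factor (pη)^(1/p) is moved between the two factors so that the second Young term is exactly
  -- η t.
  have h := Real.young_inequality_of_nonneg (a := c / (p * η) ^ (1 / p))
    (b := (p * η * t) ^ (1 / p)) (by positivity) (by positivity) hq
  rw [← Real.rpow_mul (by positivity : 0 ≤ p * η * t), one_div_mul_cancel hp0.ne', Real.rpow_one,
    Real.mul_rpow hpη.le ht, ← mul_assoc, div_mul_cancel₀ _ (Real.rpow_pos_of_pos hpη _).ne'] at h
  refine h.trans_eq ?_
  field_simp
  ring

/-! ### The direct method for uniformly convex energies -/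

section Abstract

variable {V : Type*} [AddCommGroup V] [Module ℝ V]

/-- The midpoint of a and b is admissible, so its value is at least m. Since L is affine at
midpoints, the convexity gap of E is then at most pη, and `hgap` bounds E (a - b). -/
lemma energy_sub_le_of_almost_minimal {K : Set V} {E L : V → ℝ} {p : ℝ} (hp : 0 < p)
    (hmid : ∀ a ∈ K, ∀ b ∈ K, (1 / 2 : ℝ) • (a + b) ∈ K)
    (hLmid : ∀ a ∈ K, ∀ b ∈ K, L ((1 / 2 : ℝ) • (a + b)) = (L a + L b) / 2)
    (hgap : ∀ ε > 0, ∃ C : ℝ, 0 ≤ C ∧ ∀ a ∈ K, ∀ b ∈ K,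
      E (a - b) ≤ ε * (E a + E b) + C * ((E a + E b) / 2 - E ((1 / 2 : ℝ) • (a + b))))
    {m : ℝ} (hm : ∀ a ∈ K, m ≤ 1 / p * E a - L a) (R : ℝ) {ε : ℝ} (hε : 0 < ε) :
    ∃ η > 0, ∀ a ∈ K, ∀ b ∈ K, E a ≤ R → E b ≤ R → 1 / p * E a - L a ≤ m + η →
      1 / p * E b - L b ≤ m + η → E (a - b) ≤ ε := by
  -- With E a + E b ≤ 2(|R| + 1), the first term is at most ε/2; η below gives the other half to the
  -- gap term.
  obtain ⟨C, hC, hg⟩ := hgap (ε / (4 * (|R| + 1))) (by positivity)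
  refine ⟨ε / (2 * p * (C + 1)), by positivity, fun a ha b hb haR hbR hFa hFb => ?_⟩
  refine (hg a ha b hb).trans ?_
  have h1 : ε / (4 * (|R| + 1)) * (E a + E b) ≤ ε / (4 * (|R| + 1)) * (2 * (|R| + 1)) := by
    gcongr
    linarith [le_abs_self R]
  have h2 := hm _ (hmid a ha b hb)
  rw [hLmid a ha b hb] at h2
  have h3 : (E a + E b) / 2 - E ((1 / 2 : ℝ) • (a + b)) ≤ p * (ε / (2 * p * (C + 1))) := by
    have h4 : 1 / p * ((E a + E b) / 2 - E ((1 / 2 : ℝ) • (a + b))) ≤ ε / (2 * p * (C + 1)) := by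
      linarith
    calc _ = p * (1 / p * ((E a + E b) / 2 - E ((1 / 2 : ℝ) • (a + b)))) := by field_simp
      _ ≤ _ := by gcongr
  have h5 : C * ((E a + E b) / 2 - E ((1 / 2 : ℝ) • (a + b))) ≤
      (C + 1) * (p * (ε / (2 * p * (C + 1)))) :=
    (mul_le_mul_of_nonneg_left h3 hC).trans (by gcongr; linarith)
  have h6 : ε / (4 * (|R| + 1)) * (2 * (|R| + 1)) = ε / 2 := by field_simp; norm_num
  have h7 : (C + 1) * (p * (ε / (2 * p * (C + 1)))) = ε / 2 := by field_simp
  linarith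

/-- `hA` is coercivity and bounds the infimum from below. `hcomplete` is the only analytic input:
energy-Cauchy sequences have an admissible limit, along which E is lower semicontinuous and L
continuous. -/
lemma exists_minimizer {K : Set V} (hK : K.Nonempty) {E L : V → ℝ} {p : ℝ} (hp : 0 < p)
    (hmid : ∀ a ∈ K, ∀ b ∈ K, (1 / 2 : ℝ) • (a + b) ∈ K)
    (hLmid : ∀ a ∈ K, ∀ b ∈ K, L ((1 / 2 : ℝ) • (a + b)) = (L a + L b) / 2)
    (hgap : ∀ ε > 0, ∃ C : ℝ, 0 ≤ C ∧ ∀ a ∈ K, ∀ b ∈ K,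
      E (a - b) ≤ ε * (E a + E b) + C * ((E a + E b) / 2 - E ((1 / 2 : ℝ) • (a + b))))
    (hE : ∀ a ∈ K, 0 ≤ E a)
    {A : ℝ} (hA : ∀ a ∈ K, E a ≤ A + 2 * p * (1 / p * E a - L a))
    (hcomplete : ∀ w : ℕ → V, (∀ n, w n ∈ K) →
      (∀ ε > 0, ∃ n₀, ∀ m ≥ n₀, ∀ n ≥ n₀, E (w m - w n) ≤ ε) →
      ∃ w' ∈ K, (∀ c, (∀ᶠ n in atTop, E (w n) ≤ c) → E w' ≤ c) ∧
        Tendsto (fun n => L (w n)) atTop (𝓝 (L w'))) :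
    ∃ w ∈ K, ∀ a ∈ K, 1 / p * E w - L w ≤ 1 / p * E a - L a := by
  set F : V → ℝ := fun a => 1 / p * E a - L a with hF
  have hbdd : BddBelow (F '' K) := by
    refine ⟨-A / (2 * p), ?_⟩
    rintro _ ⟨a, ha, rfl⟩
    rw [div_le_iff₀ (by positivity)]
    linarith [hA a ha, hE a ha]
  set m := sInf (F '' K) with hm
  have hmle : ∀ a ∈ K, m ≤ F a := fun a ha => csInf_le hbdd (mem_image_of_mem _ ha)
  have hseq : ∀ n : ℕ, ∃ a ∈ K, F a < m + 1 / ((n : ℝ) + 1) := by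
    intro n
    obtain ⟨_, ⟨a, ha, rfl⟩, h⟩ := exists_lt_of_csInf_lt (hK.image F)
      (lt_add_of_pos_right m (Nat.one_div_pos_of_nat (n := n)))
    exact ⟨a, ha, h⟩
  choose w hwK hwF using hseq
  have hwR : ∀ n, E (w n) ≤ A + 2 * p * (m + 1) := fun n => by
    refine (hA _ (hwK n)).trans ?_
    have : 1 / ((n : ℝ) + 1) ≤ 1 := by
      rw [div_le_one (by positivity)]; linarith [Nat.cast_nonneg (α := ℝ) n]
    have := hwF n
    gcongr
    change F (w n) ≤ _
    linarith
  obtain ⟨w', hw', hlsc, hlim⟩ := hcomplete w hwK fun ε hε => by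
    obtain ⟨η, hη, h⟩ := energy_sub_le_of_almost_minimal hp hmid hLmid hgap hmle
      (A + 2 * p * (m + 1)) hε
    obtain ⟨n₀, hn₀⟩ := exists_nat_one_div_lt hη
    have hle : ∀ n ≥ n₀, F (w n) ≤ m + η := fun n hn => by
      have := Nat.one_div_le_one_div (α := ℝ) hn
      linarith [hwF n]
    exact ⟨n₀, fun i hi j hj => h _ (hwK i) _ (hwK j) (hwR i) (hwR j) (hle i hi) (hle j hj)⟩
  refine ⟨w', hw', fun a ha => (?_ : F w' ≤ m).trans (hmle a ha)⟩
  -- Along the sequence E = p(F + L), and the right side tends to p(m + L w'); each level above this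
  -- limit can be used in the lower semicontinuity.
  have hEw : E w' ≤ p * (m + L w') := by
    refine le_of_forall_pos_le_add fun ε hε => hlsc _ ?_
    have h1 : Tendsto (fun n : ℕ => p * (m + 1 / ((n : ℝ) + 1) + L (w n))) atTop
        (𝓝 (p * (m + 0 + L w'))) :=
      ((tendsto_one_div_add_atTop_nhds_zero_nat.const_add m).add hlim).const_mul p
    rw [add_zero] at h1
    filter_upwards [h1.eventually (gt_mem_nhds (lt_add_of_pos_right _ hε))] with n hn
    have h2 := hwF n
    have h3 : E (w n) = p * (F (w n) + L (w n)) := by simp only [hF]; field_simp; ring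
    rw [h3]
    refine le_trans ?_ hn.le
    gcongr
  calc F w' = 1 / p * E w' - L w' := rfl
    _ ≤ 1 / p * (p * (m + L w')) - L w' := by gcongr
    _ = m := by field_simp; ring

/-- Comparing W j and w in both functionals, with `Lj j` uniformly close to L on {E ≤ R}, gives
convergence of the minima and makes W j almost minimal for the limit functional. -/
lemma tendsto_min_and_energy_sub {K : Set V} {E : V → ℝ} {p : ℝ} (hp : 0 < p)
    (hmid : ∀ a ∈ K, ∀ b ∈ K, (1 / 2 : ℝ) • (a + b) ∈ K)
    (hgap : ∀ ε > 0, ∃ C : ℝ, 0 ≤ C ∧ ∀ a ∈ K, ∀ b ∈ K,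
      E (a - b) ≤ ε * (E a + E b) + C * ((E a + E b) / 2 - E ((1 / 2 : ℝ) • (a + b))))
    {L : V → ℝ} {Lj : ℕ → V → ℝ}
    (hLmid : ∀ a ∈ K, ∀ b ∈ K, L ((1 / 2 : ℝ) • (a + b)) = (L a + L b) / 2)
    {A : ℝ} (hA : ∀ j, ∀ a ∈ K, E a ≤ A + 2 * p * (1 / p * E a - Lj j a))
    (hclose : ∀ R, ∀ ε > 0, ∀ᶠ j in atTop, ∀ a ∈ K, E a ≤ R → |Lj j a - L a| ≤ ε)
    {W : ℕ → V} {w : V} (hW : ∀ j, W j ∈ K) (hw : w ∈ K)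
    (hWmin : ∀ j, ∀ a ∈ K, 1 / p * E (W j) - Lj j (W j) ≤ 1 / p * E a - Lj j a)
    (hwmin : ∀ a ∈ K, 1 / p * E w - L w ≤ 1 / p * E a - L a) :
    Tendsto (fun j => 1 / p * E (W j) - Lj j (W j)) atTop (𝓝 (1 / p * E w - L w)) ∧
      ∀ ε > 0, ∀ᶠ j in atTop, E (W j - w) ≤ ε := by
  set m := 1 / p * E w - L w with hm
  -- R bounds E w, and also E (W j) for large j: coercivity together with the competitor w, whose
  -- value differs from m by at most 1.
  set R := max (E w) (A + 2 * p * (m + 1)) with hR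
  have hWR : ∀ᶠ j in atTop, E (W j) ≤ R := by
    filter_upwards [hclose (E w) 1 one_pos] with j hj
    refine le_trans ((hA j _ (hW j)).trans ?_) (le_max_right _ _)
    have h1 := hWmin j w hw
    have h2 := abs_le.1 (hj w hw le_rfl)
    gcongr
    linarith
  have hmain : ∀ ε > 0, ∀ᶠ j in atTop, E (W j) ≤ R ∧
      |(1 / p * E (W j) - Lj j (W j)) - m| ≤ ε ∧ 1 / p * E (W j) - L (W j) ≤ m + 2 * ε := by
    intro ε hε
    filter_upwards [hWR, hclose R ε hε] with j hjR hj
    have h1 := hWmin j w hw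
    have h2 := hwmin _ (hW j)
    have h3 := abs_le.1 (hj w hw (le_max_left _ _))
    have h4 := abs_le.1 (hj _ (hW j) hjR)
    refine ⟨hjR, abs_le.2 ⟨by linarith, by linarith⟩, by linarith⟩
  constructor
  · rw [Metric.tendsto_nhds]
    intro ε hε
    filter_upwards [hmain (ε / 2) (by positivity)] with j hj
    rw [Real.dist_eq]
    linarith [hj.2.1]
  · intro ε hε
    obtain ⟨η, hη, h⟩ := energy_sub_le_of_almost_minimal hp hmid hLmid hgap hwmin R hε
    filter_upwards [hmain (η / 2) (by positivity)] with j hj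
    exact h _ (hW j) _ hw hj.1 (le_max_left _ _) (by linarith [hj.2.2]) (by linarith)

end Abstract

/-! ### Geometry of the extended domain. -/

section Domain

variable {N : ℕ} {Ω : Set (Eucl N)} {δ : ℝ}

lemma isOpen_extendedDomain (hΩ : IsOpen Ω) : IsOpen (extendedDomain Ω δ) :=
  hΩ.union (isOpen_biUnion fun _ _ => Metric.isOpen_ball)

lemma subset_extendedDomain : Ω ⊆ extendedDomain Ω δ := subset_union_left

lemma isBounded_extendedDomain (hΩb : Bornology.IsBounded Ω) :
    Bornology.IsBounded (extendedDomain Ω δ) := by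
  refine hΩb.union (((hΩb.closure.subset frontier_subset_closure).thickening (δ := δ)).subset ?_)
  rw [Metric.thickening_eq_biUnion_ball]

/-- If y is outside Ω, the segment from x to y meets the boundary at a point no farther from y than
x is. Thus the horizon of a point of Ω is not truncated by Ω_δ. -/
lemma mem_extendedDomain_of_dist_lt (hΩ : IsOpen Ω) {x y : Eucl N} (hx : x ∈ Ω)
    (hxy : dist x y < δ) : y ∈ extendedDomain Ω δ := by
  by_cases hy : y ∈ Ω
  · exact Or.inl hy
  · obtain ⟨q, hq1, hq2⟩ : ∃ q ∈ segment ℝ x y, q ∈ frontier Ω := by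
      by_contra! hne
      obtain ⟨z, -, hz1, hz2⟩ := (convex_segment x y).isPreconnected Ω (closure Ω)ᶜ hΩ
        isClosed_closure.isOpen_compl
        (fun q hq => or_iff_not_imp_left.2 fun h1 h2 => hne q hq (hΩ.frontier_eq ▸ ⟨h2, h1⟩))
        ⟨x, left_mem_segment ℝ x y, hx⟩
        ⟨y, right_mem_segment ℝ x y, fun h => hne y (right_mem_segment ℝ x y)
          (hΩ.frontier_eq ▸ ⟨h, hy⟩)⟩
      exact hz2 (subset_closure hz1)
    refine Or.inr (mem_biUnion hq2 ?_)
    have h := dist_add_dist_of_mem_segment hq1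
    rw [Metric.mem_ball, dist_comm]
    linarith [dist_nonneg (x := x) (y := q)]

lemma isFiniteMeasure_extVol (hΩb : Bornology.IsBounded Ω) : IsFiniteMeasure (extVol Ω δ) :=
  ⟨by
    rw [extVol, Measure.restrict_apply_univ]
    exact (isBounded_extendedDomain hΩb).measure_lt_top⟩

lemma volume_restrict_le_extVol : (volume.restrict Ω : Measure (Eucl N)) ≤ extVol Ω δ :=
  Measure.restrict_mono subset_extendedDomain le_rfl

lemma ae_extVol {P : Eucl N → Prop} (h1 : ∀ᵐ x ∂(volume.restrict Ω), P x)
    (h2 : ∀ᵐ x ∂(collarVol Ω δ), P x) : ∀ᵐ x ∂(extVol Ω δ), P x := by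
  have h : extendedDomain Ω δ = Ω ∪ (extendedDomain Ω δ \ Ω) :=
    (union_sdiff_cancel subset_extendedDomain).symm
  rw [extVol, h, ae_restrict_union_iff]
  exact ⟨h1, h2⟩

lemma ae_extVol_imp_of_collar (hΩ : IsOpen Ω) {P : Eucl N → Prop}
    (h : ∀ᵐ x ∂(collarVol Ω δ), P x) :
    ∀ᵐ x ∂(extVol Ω δ), x ∉ Ω → P x :=
  ae_extVol ((ae_restrict_mem hΩ.measurableSet).mono fun _ hx hx' => absurd hx hx')
    (h.mono fun _ hx _ => hx)

lemma collarVol_le_extVol : collarVol Ω δ ≤ extVol Ω δ :=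
  Measure.restrict_mono sdiff_subset le_rfl

end Domain

/-! ### Measurability, integrability and lower semicontinuity for a general weight. -/

section Energy

variable {N : ℕ} {p : ℝ} {k : ℝ → ℝ} {H : Eucl N → Eucl N → ℝ}

lemma formIntegrand_eq (u v : Eucl N → ℝ) (z : Eucl N × Eucl N) :
    formIntegrand p k H u v z = H z.2 z.1 * (k ‖z.2 - z.1‖ / ‖z.2 - z.1‖ ^ p) *
      (|u z.2 - u z.1| ^ (p - 2) * (u z.2 - u z.1) * (v z.2 - v z.1)) := by
  unfold formIntegrand; ring

lemma formIntegrand_self (hp : 1 < p) (u : Eucl N → ℝ) (z : Eucl N × Eucl N) :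
    formIntegrand p k H u u z = H z.2 z.1 * (k ‖z.2 - z.1‖ / ‖z.2 - z.1‖ ^ p) *
      |u z.2 - u z.1| ^ p := by
  rw [formIntegrand_eq, abs_rpow_sub_two_mul_self_mul_self hp]

variable {μ : Measure (Eucl N)}

lemma measurable_kernel (hk : Measurable k) :
    Measurable fun z : Eucl N × Eucl N => k ‖z.2 - z.1‖ / ‖z.2 - z.1‖ ^ p := by
  have h : Measurable fun z : Eucl N × Eucl N => ‖z.2 - z.1‖ :=
    (measurable_snd.sub measurable_fst).norm
  exact (hk.comp h).div (h.pow_const p)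

lemma aemeasurable_formIntegrand (hk : Measurable k)
    (hH : AEMeasurable (fun z : Eucl N × Eucl N => H z.2 z.1) (μ.prod μ)) {u v : Eucl N → ℝ}
    (hu : AEStronglyMeasurable u μ) (hv : AEStronglyMeasurable v μ) :
    AEMeasurable (formIntegrand p k H u v) (μ.prod μ) := by
  have hD : ∀ w : Eucl N → ℝ, AEStronglyMeasurable w μ →
      AEMeasurable (fun z : Eucl N × Eucl N => w z.2 - w z.1) (μ.prod μ) := fun w hw =>
    (hw.comp_snd.sub hw.comp_fst).aemeasurable
  have : formIntegrand p k H u v = fun z => H z.2 z.1 * (k ‖z.2 - z.1‖ / ‖z.2 - z.1‖ ^ p) *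
      (|u z.2 - u z.1| ^ (p - 2) * (u z.2 - u z.1) * (v z.2 - v z.1)) :=
    funext (formIntegrand_eq u v)
  rw [this]
  exact (hH.mul (measurable_kernel hk).aemeasurable).mul
    ((((hD u hu).norm.pow_const _).mul (hD u hu)).mul (hD v hv))

lemma integrable_formIntegrand_linear_combination (hp : 1 < p) (hk : Measurable k)
    (hk0 : ∀ r, 0 ≤ k r)
    (hH : AEMeasurable (fun z : Eucl N × Eucl N => H z.2 z.1) (μ.prod μ))
    (hH0 : ∀ᵐ z ∂(μ.prod μ), 0 ≤ H z.2 z.1) {u v : Eucl N → ℝ}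
    (hu : AEStronglyMeasurable u μ) (hv : AEStronglyMeasurable v μ)
    (hui : Integrable (formIntegrand p k H u u) (μ.prod μ))
    (hvi : Integrable (formIntegrand p k H v v) (μ.prod μ)) (α β : ℝ) :
    Integrable (formIntegrand p k H (α • u + β • v) (α • u + β • v)) (μ.prod μ) := by
  have hm : AEStronglyMeasurable (α • u + β • v) μ := (hu.const_smul α).add (hv.const_smul β)
  refine (((hui.const_mul (|α| ^ p)).add (hvi.const_mul (|β| ^ p))).const_mul
    (2 ^ (p - 1))).mono' (aemeasurable_formIntegrand hk hH hm hm).aestronglyMeasurable ?_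
  filter_upwards [hH0] with z hz
  have hw : 0 ≤ H z.2 z.1 * (k ‖z.2 - z.1‖ / ‖z.2 - z.1‖ ^ p) :=
    mul_nonneg hz (div_nonneg (hk0 _) (by positivity))
  simp only [Pi.add_apply, formIntegrand_self hp]
  rw [Real.norm_of_nonneg (by positivity)]
  have h1 := abs_sub_rpow_le hp (α * (u z.2 - u z.1)) (-β * (v z.2 - v z.1))
  rw [abs_mul, abs_mul, abs_neg, Real.mul_rpow (abs_nonneg _) (abs_nonneg _),
    Real.mul_rpow (abs_nonneg _) (abs_nonneg _)] at h1
  have h2 : (α • u + β • v) z.2 - (α • u + β • v) z.1 =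
      α * (u z.2 - u z.1) - -β * (v z.2 - v z.1) := by
    simp only [Pi.add_apply, Pi.smul_apply, smul_eq_mul]; ring
  simp only [Pi.add_apply, Pi.smul_apply, smul_eq_mul] at h2 ⊢
  rw [h2]
  refine (mul_le_mul_of_nonneg_left h1 hw).trans_eq (by ring)

/-- Young's inequality dominates the mixed integrand by the two diagonal ones. -/
lemma integrable_formIntegrand (hp : 1 < p) (hk : Measurable k) (hk0 : ∀ r, 0 ≤ k r)
    (hH : AEMeasurable (fun z : Eucl N × Eucl N => H z.2 z.1) (μ.prod μ))
    (hH0 : ∀ᵐ z ∂(μ.prod μ), 0 ≤ H z.2 z.1) {u v : Eucl N → ℝ}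
    (hu : AEStronglyMeasurable u μ) (hv : AEStronglyMeasurable v μ)
    (hui : Integrable (formIntegrand p k H u u) (μ.prod μ))
    (hvi : Integrable (formIntegrand p k H v v) (μ.prod μ)) :
    Integrable (formIntegrand p k H u v) (μ.prod μ) := by
  refine ((hui.const_mul ((p - 1) / p)).add (hvi.const_mul (1 / p))).mono'
    (aemeasurable_formIntegrand hk hH hu hv).aestronglyMeasurable ?_
  filter_upwards [hH0] with z hz
  have hw : 0 ≤ H z.2 z.1 * (k ‖z.2 - z.1‖ / ‖z.2 - z.1‖ ^ p) :=
    mul_nonneg hz (div_nonneg (hk0 _) (by positivity))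
  simp only [Pi.add_apply, formIntegrand_self hp]
  rw [formIntegrand_eq, norm_mul, Real.norm_of_nonneg hw, Real.norm_eq_abs, abs_mul,
    abs_abs_rpow_sub_two_mul hp]
  have h1 := mul_rpow_sub_one_mul_le hp (abs_nonneg (u z.2 - u z.1)) (abs_nonneg (v z.2 - v z.1))
  have hp0 : 0 < p := by linarith
  have h2 : |u z.2 - u z.1| ^ (p - 1) * |v z.2 - v z.1| ≤
      (p - 1) / p * |u z.2 - u z.1| ^ p + 1 / p * |v z.2 - v z.1| ^ p := by
    calc _ = 1 / p * (p * (|u z.2 - u z.1| ^ (p - 1) * |v z.2 - v z.1|)) := by field_simp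
      _ ≤ 1 / p * ((p - 1) * |u z.2 - u z.1| ^ p + |v z.2 - v z.1| ^ p) := by gcongr
      _ = _ := by ring
  exact (mul_le_mul_of_nonneg_left h2 hw).trans_eq (by ring)

/-- Fatou's lemma for the nonlocal energy. -/
lemma integrable_formIntegrand_of_ae_tendsto (hp : 1 < p) (hk : Measurable k)
    (hk0 : ∀ r, 0 ≤ k r)
    (hH : AEMeasurable (fun z : Eucl N × Eucl N => H z.2 z.1) (μ.prod μ))
    (hH0 : ∀ᵐ z ∂(μ.prod μ), 0 ≤ H z.2 z.1) {v : ℕ → Eucl N → ℝ} {v' : Eucl N → ℝ}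
    (hv : ∀ n, AEStronglyMeasurable (v n) μ) (hv' : AEStronglyMeasurable v' μ)
    (hlim : ∀ᵐ x ∂μ, Tendsto (fun n => v n x) atTop (𝓝 (v' x)))
    (hvi : ∀ n, Integrable (formIntegrand p k H (v n) (v n)) (μ.prod μ)) {c : ℝ}
    (hc : ∀ᶠ n in atTop, ∫ z, formIntegrand p k H (v n) (v n) z ∂(μ.prod μ) ≤ c) :
    Integrable (formIntegrand p k H v' v') (μ.prod μ) ∧
      ∫ z, formIntegrand p k H v' v' z ∂(μ.prod μ) ≤ c := by
  have hnn : ∀ w : Eucl N → ℝ, 0 ≤ᵐ[μ.prod μ] formIntegrand p k H w w := fun w => by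
    filter_upwards [hH0] with z hz
    rw [formIntegrand_self hp]
    exact mul_nonneg (mul_nonneg hz (div_nonneg (hk0 _) (by positivity))) (by positivity)
  have hmeas := aemeasurable_formIntegrand (p := p) hk hH hv' hv'
  -- Required to pass from the `ENNReal.ofReal` inequality back to the reals at the end.
  have hc0 : 0 ≤ c := by
    obtain ⟨n, hn⟩ := hc.exists
    exact (integral_nonneg_of_ae (hnn _)).trans hn
  have hl : ∀ᵐ z ∂(μ.prod μ), Tendsto (fun n => formIntegrand p k H (v n) (v n) z) atTop
      (𝓝 (formIntegrand p k H v' v' z)) := by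
    filter_upwards [Measure.quasiMeasurePreserving_fst.ae hlim,
      Measure.quasiMeasurePreserving_snd.ae hlim] with z h1 h2
    simp only [formIntegrand_self hp]
    exact ((h2.sub h1).abs.rpow_const (Or.inr (by linarith))).const_mul _
  have hF : ∫⁻ z, ENNReal.ofReal (formIntegrand p k H v' v' z) ∂(μ.prod μ) ≤ ENNReal.ofReal c := by
    calc ∫⁻ z, ENNReal.ofReal (formIntegrand p k H v' v' z) ∂(μ.prod μ)
        = ∫⁻ z, liminf (fun n => ENNReal.ofReal (formIntegrand p k H (v n) (v n) z)) atTop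
            ∂(μ.prod μ) := by
          refine lintegral_congr_ae (hl.mono fun z hz => ?_)
          exact ((ENNReal.continuous_ofReal.tendsto _).comp hz).liminf_eq.symm
      _ ≤ liminf (fun n => ∫⁻ z, ENNReal.ofReal (formIntegrand p k H (v n) (v n) z)
            ∂(μ.prod μ)) atTop :=
          lintegral_liminf_le' fun n =>
            (aemeasurable_formIntegrand hk hH (hv n) (hv n)).ennreal_ofReal
      _ ≤ ENNReal.ofReal c := by
          refine liminf_le_of_le (by isBoundedDefault) fun b hb => ?_
          obtain ⟨n, h1, h2⟩ := (hb.and hc).exists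
          refine h1.trans ?_
          rw [← ofReal_integral_eq_lintegral_ofReal (hvi n) (hnn _)]
          exact ENNReal.ofReal_le_ofReal h2
  have hint : Integrable (formIntegrand p k H v' v') (μ.prod μ) := by
    refine ⟨hmeas.aestronglyMeasurable, ?_⟩
    rw [hasFiniteIntegral_iff_ofReal (hnn _)]
    exact hF.trans_lt ENNReal.ofReal_lt_top
  refine ⟨hint, ?_⟩
  rw [← ofReal_integral_eq_lintegral_ofReal hint (hnn _)] at hF
  exact (ENNReal.ofReal_le_ofReal_iff hc0).1 hF

end Energy

/-! ### Bounds on the weight, and convexity of the form on the energy space. -/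

section Spaces

variable {N : ℕ} {p s c₀ δ hmin hmax : ℝ} {Ω : Set (Eucl N)} {k : ℝ → ℝ} {h : Eucl N → ℝ}

/-- Only hmin/2 survives below when one point lies in Ω, as h may vanish at the other; on collar ×
collar the weight gives no lower bound. -/
lemma IsCoefficient.ae_prod (hΩ : IsOpen Ω) (hhmin : 0 < hmin) (hhmax : hmin < hmax)
    (hh : IsCoefficient Ω δ hmin hmax h) :
    ∀ᵐ z ∂((extVol Ω δ).prod (extVol Ω δ)), 0 ≤ (h z.2 + h z.1) / 2 ∧
      (h z.2 + h z.1) / 2 ≤ hmax ∧ (z.1 ∈ Ω ∨ z.2 ∈ Ω → hmin / 2 ≤ (h z.2 + h z.1) / 2) := by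
  have h1 : ∀ᵐ x ∂(extVol Ω δ), 0 ≤ h x ∧ h x ≤ hmax ∧ (x ∈ Ω → hmin ≤ h x) := by
    refine ae_extVol (hh.mem_Icc.mono fun x hx => ⟨hhmin.le.trans hx.1, hx.2, fun _ => hx.1⟩) ?_
    have h2 : ∀ᵐ x ∂(collarVol Ω δ), x ∉ Ω :=
      (ae_restrict_mem ((isOpen_extendedDomain hΩ).measurableSet.diff hΩ.measurableSet)).mono
        fun x hx => hx.2
    filter_upwards [hh.eq_zero, h2] with x hx hx'
    exact ⟨hx.ge, hx.le.trans (by linarith), fun h => absurd h hx'⟩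
  filter_upwards [Measure.quasiMeasurePreserving_fst.ae h1,
    Measure.quasiMeasurePreserving_snd.ae h1] with z h1 h2
  refine ⟨by linarith [h1.1, h2.1], by linarith [h1.2.1, h2.2.1], ?_⟩
  rintro (hz | hz)
  · linarith [h1.2.2 hz, h2.1]
  · linarith [h2.2.2 hz, h1.1]

lemma IsCoefficient.aemeasurable_prod (hh : IsCoefficient Ω δ hmin hmax h) :
    AEMeasurable (fun z : Eucl N × Eucl N => (h z.2 + h z.1) / 2)
      ((extVol Ω δ).prod (extVol Ω δ)) :=
  ((hh.aemeasurable.comp_quasiMeasurePreserving Measure.quasiMeasurePreserving_snd).add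
    (hh.aemeasurable.comp_quasiMeasurePreserving Measure.quasiMeasurePreserving_fst)).div_const 2

lemma energySpace_linear_combination (hp : 1 < p) (hk : IsKernel N p s c₀ δ k) {u v : Eucl N → ℝ}
    (hu : u ∈ energySpace Ω δ p k) (hv : v ∈ energySpace Ω δ p k) (α β : ℝ) :
    α • u + β • v ∈ energySpace Ω δ p k :=
  ⟨(hu.1.const_smul α).add (hv.1.const_smul β),
    integrable_formIntegrand_linear_combination hp hk.measurable hk.nonneg aemeasurable_const
      (Eventually.of_forall fun _ => zero_le_one) hu.1.1 hv.1.1 hu.2 hv.2 α β⟩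

lemma energySpace_sub (hp : 1 < p) (hk : IsKernel N p s c₀ δ k) {u v : Eucl N → ℝ}
    (hu : u ∈ energySpace Ω δ p k) (hv : v ∈ energySpace Ω δ p k) :
    u - v ∈ energySpace Ω δ p k := by
  simpa [sub_eq_add_neg] using energySpace_linear_combination hp hk hu hv 1 (-1)

lemma energySpace_midpoint (hp : 1 < p) (hk : IsKernel N p s c₀ δ k) {u v : Eucl N → ℝ}
    (hu : u ∈ energySpace Ω δ p k) (hv : v ∈ energySpace Ω δ p k) :
    (1 / 2 : ℝ) • (u + v) ∈ energySpace Ω δ p k := by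
  rw [smul_add]
  exact energySpace_linear_combination hp hk hu hv _ _

lemma competitors_midpoint (hp : 1 < p) (hk : IsKernel N p s c₀ δ k) {u₀ u v : Eucl N → ℝ}
    (hu : u ∈ competitors Ω δ p k u₀) (hv : v ∈ competitors Ω δ p k u₀) :
    (1 / 2 : ℝ) • (u + v) ∈ competitors Ω δ p k u₀ := by
  refine ⟨energySpace_midpoint hp hk hu.1 hv.1, ?_⟩
  filter_upwards [hu.2, hv.2] with x h1 h2
  simp [h1, h2]; ring

lemma competitors_sub (hp : 1 < p) (hk : IsKernel N p s c₀ δ k) {u₀ u v : Eucl N → ℝ}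
    (hu : u ∈ competitors Ω δ p k u₀) (hv : v ∈ competitors Ω δ p k u₀) :
    u - v ∈ energySpaceZero Ω δ p k := by
  refine ⟨energySpace_sub hp hk hu.1 hv.1, ?_⟩
  filter_upwards [hu.2, hv.2] with x h1 h2
  simp [h1, h2]

lemma integrable_form_self (hp : 1 < p) (hΩ : IsOpen Ω) (hhmin : 0 < hmin) (hhmax : hmin < hmax)
    (hk : IsKernel N p s c₀ δ k) (hh : IsCoefficient Ω δ hmin hmax h) {u : Eucl N → ℝ}
    (hu : u ∈ energySpace Ω δ p k) :
    Integrable (formIntegrand p k (fun x' x => (h x' + h x) / 2) u u)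
      ((extVol Ω δ).prod (extVol Ω δ)) := by
  refine (hu.2.const_mul hmax).mono' (aemeasurable_formIntegrand hk.measurable
    hh.aemeasurable_prod hu.1.1 hu.1.1).aestronglyMeasurable ?_
  filter_upwards [hh.ae_prod hΩ hhmin hhmax] with z hz
  have hw : 0 ≤ k ‖z.2 - z.1‖ / ‖z.2 - z.1‖ ^ p := div_nonneg (hk.nonneg _) (by positivity)
  rw [formIntegrand_self hp, formIntegrand_self hp,
    Real.norm_of_nonneg (mul_nonneg (mul_nonneg hz.1 hw) (by positivity)), one_mul, ← mul_assoc]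
  gcongr
  exact hz.2.1

lemma form_self_nonneg (hp : 1 < p) (hΩ : IsOpen Ω) (hhmin : 0 < hmin) (hhmax : hmin < hmax)
    (hk : IsKernel N p s c₀ δ k) (hh : IsCoefficient Ω δ hmin hmax h) (u : Eucl N → ℝ) :
    0 ≤ form Ω δ p k h u u := by
  refine integral_nonneg_of_ae ?_
  filter_upwards [hh.ae_prod hΩ hhmin hhmax] with z hz
  rw [formIntegrand_self hp]
  exact mul_nonneg (mul_nonneg hz.1 (div_nonneg (hk.nonneg _) (by positivity))) (by positivity)

lemma form_sub_self_le (hp : 1 < p) (hΩ : IsOpen Ω) (hhmin : 0 < hmin) (hhmax : hmin < hmax)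
    (hk : IsKernel N p s c₀ δ k) (hh : IsCoefficient Ω δ hmin hmax h) {u v : Eucl N → ℝ}
    (hu : u ∈ energySpace Ω δ p k) (hv : v ∈ energySpace Ω δ p k) :
    form Ω δ p k h (u - v) (u - v) ≤
      2 ^ (p - 1) * (form Ω δ p k h u u + form Ω δ p k h v v) := by
  have hi {w} := integrable_form_self (u := w) hp hΩ hhmin hhmax hk hh
  unfold form
  rw [← integral_add (hi hu) (hi hv), ← integral_const_mul]
  refine integral_mono_ae (hi (energySpace_sub hp hk hu hv)) (((hi hu).add (hi hv)).const_mul _) ?_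
  filter_upwards [hh.ae_prod hΩ hhmin hhmax] with z hz
  have hw : 0 ≤ k ‖z.2 - z.1‖ / ‖z.2 - z.1‖ ^ p := div_nonneg (hk.nonneg _) (by positivity)
  simp only [formIntegrand_self hp, Pi.sub_apply]
  have h1 := abs_sub_rpow_le hp (u z.2 - u z.1) (v z.2 - v z.1)
  rw [sub_sub_sub_comm] at h1
  exact (mul_le_mul_of_nonneg_left h1 (mul_nonneg hz.1 hw)).trans_eq (by ring)

/-- The scalar inequality, applied to the increments of u and v, is multiplied by the nonnegative
weight and integrated; C depends only on p and ε. -/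
lemma form_convexity_gap (hp : 1 < p) (hΩ : IsOpen Ω) (hhmin : 0 < hmin) (hhmax : hmin < hmax)
    (hk : IsKernel N p s c₀ δ k) (hh : IsCoefficient Ω δ hmin hmax h) {ε : ℝ} (hε : 0 < ε) :
    ∃ C : ℝ, 0 ≤ C ∧ ∀ u ∈ energySpace Ω δ p k, ∀ v ∈ energySpace Ω δ p k,
      form Ω δ p k h (u - v) (u - v) ≤ ε * (form Ω δ p k h u u + form Ω δ p k h v v) +
        C * ((form Ω δ p k h u u + form Ω δ p k h v v) / 2 -
          form Ω δ p k h ((1 / 2 : ℝ) • (u + v)) ((1 / 2 : ℝ) • (u + v))) := by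
  obtain ⟨C, hC, hgap⟩ := exists_convexity_gap hp hε
  refine ⟨C, hC, fun u hu v hv => ?_⟩
  have hi {w} := integrable_form_self (u := w) hp hΩ hhmin hhmax hk hh
  have hm := hi (energySpace_midpoint hp hk hu hv)
  have hsum := (hi hu).add (hi hv)
  have h3 := integral_add (hsum.const_mul ε) (((hsum.div_const 2).sub hm).const_mul C)
  rw [integral_const_mul, integral_const_mul, integral_sub' (hsum.div_const 2) hm, integral_div,
    integral_add' (hi hu) (hi hv)] at h3
  unfold form
  rw [← h3]
  refine integral_mono_ae (hi (energySpace_sub hp hk hu hv))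
    ((hsum.const_mul ε).add (((hsum.div_const 2).sub hm).const_mul C)) ?_
  filter_upwards [hh.ae_prod hΩ hhmin hhmax] with z hz
  have hw : 0 ≤ k ‖z.2 - z.1‖ / ‖z.2 - z.1‖ ^ p := div_nonneg (hk.nonneg _) (by positivity)
  have h1 := hgap (u z.2 - u z.1) (v z.2 - v z.1)
  rw [sub_sub_sub_comm] at h1
  have h2 : ((1 / 2 : ℝ) • (u + v)) z.2 - ((1 / 2 : ℝ) • (u + v)) z.1 =
      (u z.2 - u z.1 + (v z.2 - v z.1)) / 2 := by
    simp only [Pi.smul_apply, Pi.add_apply, smul_eq_mul]; ring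
  simp only [formIntegrand_self hp, h2, Pi.sub_apply, Pi.add_apply]
  exact (mul_le_mul_of_nonneg_left h1 (mul_nonneg hz.1 hw)).trans_eq (by ring)

lemma form_tangent_le (hp : 1 < p) (hΩ : IsOpen Ω) (hhmin : 0 < hmin) (hhmax : hmin < hmax)
    (hk : IsKernel N p s c₀ δ k) (hh : IsCoefficient Ω δ hmin hmax h) {u v : Eucl N → ℝ}
    (hu : u ∈ energySpace Ω δ p k) (hv : v ∈ energySpace Ω δ p k) :
    p * form Ω δ p k h u (v - u) ≤ form Ω δ p k h v v - form Ω δ p k h u u := by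
  have hi {w} := integrable_form_self (u := w) hp hΩ hhmin hhmax hk hh
  have hvu := energySpace_sub hp hk hv hu
  have hae := hh.ae_prod hΩ hhmin hhmax
  unfold form
  rw [← integral_sub (hi hv) (hi hu), ← integral_const_mul]
  refine integral_mono_ae ((integrable_formIntegrand hp hk.measurable hk.nonneg
    hh.aemeasurable_prod (hae.mono fun z hz => hz.1) hu.1.1 hvu.1.1 (hi hu) (hi hvu)).const_mul p)
    ((hi hv).sub (hi hu)) ?_
  filter_upwards [hae] with z hz
  have hw : 0 ≤ k ‖z.2 - z.1‖ / ‖z.2 - z.1‖ ^ p := div_nonneg (hk.nonneg _) (by positivity)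
  have h1 := rpow_abs_tangent_le hp (u z.2 - u z.1) (v z.2 - v z.1)
  rw [sub_sub_sub_comm] at h1
  rw [formIntegrand_eq]
  simp only [formIntegrand_self hp, Pi.sub_apply]
  refine Eq.trans_le (by ring) ((mul_le_mul_of_nonneg_left h1 (mul_nonneg hz.1 hw)).trans_eq
    (by ring))

/-- A state minimizes the Dirichlet functional among the competitors. -/
lemma IsState.dirichletFunctional_le (hp : 1 < p) (hΩ : IsOpen Ω) (hhmin : 0 < hmin)
    (hhmax : hmin < hmax) (hk : IsKernel N p s c₀ δ k) (hh : IsCoefficient Ω δ hmin hmax h)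
    {u₀ g u v : Eucl N → ℝ} (hu : IsState Ω δ p k h u₀ g u) (hv : v ∈ competitors Ω δ p k u₀)
    (hgu : IntegrableOn (fun x => g x * u x) Ω) (hgv : IntegrableOn (fun x => g x * v x) Ω) :
    dirichletFunctional Ω δ p k h g u ≤ dirichletFunctional Ω δ p k h g v := by
  have h1 := form_tangent_le hp hΩ hhmin hhmax hk hh hu.1.1 hv.1
  have h2 : ∫ x in Ω, g x * (v - u) x = (∫ x in Ω, g x * v x) - ∫ x in Ω, g x * u x := by
    rw [← integral_sub hgv hgu]
    simp only [Pi.sub_apply, mul_sub]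
  -- Testing the state equation with v - u ∈ X₀ turns the tangent term into a difference of source
  -- terms.
  rw [hu.2 _ (competitors_sub hp hk hv hu.1), h2] at h1
  unfold dirichletFunctional
  have hp0 : 0 < p := by linarith
  have h3 := mul_le_mul_of_nonneg_left h1 (one_div_pos.2 hp0).le
  rw [← mul_assoc, one_div_mul_cancel hp0.ne', one_mul, mul_sub] at h3
  linarith

/-- On collar × collar, where the weight degenerates, increments of elements of X₀ vanish. -/
lemma ae_prod_eq_zero_or (hΩ : IsOpen Ω) {v : Eucl N → ℝ}
    (hv : ∀ᵐ x ∂(collarVol Ω δ), v x = 0) :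
    ∀ᵐ z ∂((extVol Ω δ).prod (extVol Ω δ)), v z.2 - v z.1 = 0 ∨ z.1 ∈ Ω ∨ z.2 ∈ Ω := by
  have h0 := ae_extVol_imp_of_collar hΩ hv
  filter_upwards [Measure.quasiMeasurePreserving_fst.ae h0,
    Measure.quasiMeasurePreserving_snd.ae h0] with z h1 h2
  by_cases hz1 : z.1 ∈ Ω
  · exact Or.inr (Or.inl hz1)
  · by_cases hz2 : z.2 ∈ Ω
    · exact Or.inr (Or.inr hz2)
    · exact Or.inl (by rw [h1 hz1, h2 hz2, sub_zero])

/-- Recovers the unweighted energy, which defines X, from the weighted one; 2/hmin is the reciprocal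
of the lower bound on the weight. -/
lemma integral_formIntegrand_one_le (hp : 1 < p) (hΩ : IsOpen Ω) (hhmin : 0 < hmin)
    (hhmax : hmin < hmax) (hk : IsKernel N p s c₀ δ k) (hh : IsCoefficient Ω δ hmin hmax h)
    {v : Eucl N → ℝ} (hv : v ∈ energySpaceZero Ω δ p k) :
    ∫ z, formIntegrand p k (fun _ _ => 1) v v z ∂((extVol Ω δ).prod (extVol Ω δ)) ≤
      2 / hmin * form Ω δ p k h v v := by
  unfold form
  rw [← integral_const_mul]
  refine integral_mono_ae hv.1.2
    ((integrable_form_self hp hΩ hhmin hhmax hk hh hv.1).const_mul _) ?_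
  filter_upwards [hh.ae_prod hΩ hhmin hhmax, ae_prod_eq_zero_or hΩ hv.2] with z hz hz'
  have hw : 0 ≤ k ‖z.2 - z.1‖ / ‖z.2 - z.1‖ ^ p := div_nonneg (hk.nonneg _) (by positivity)
  simp only [formIntegrand_self hp]
  rcases hz' with h0 | h0
  · simp [h0, Real.zero_rpow (by linarith : p ≠ 0)]
  · have h1 : 1 ≤ 2 / hmin * ((h z.2 + h z.1) / 2) := by
      rw [div_mul_eq_mul_div, le_div_iff₀ hhmin]
      linarith [hz.2.2 h0]
    calc _ ≤ (2 / hmin * ((h z.2 + h z.1) / 2)) * (k ‖z.2 - z.1‖ / ‖z.2 - z.1‖ ^ p) *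
        |v z.2 - v z.1| ^ p := by gcongr
      _ = _ := by ring

end Spaces

/-! ### The Poincaré inequality by repeated translation. -/

section Poincare

variable {N : ℕ} {p s c₀ δ hmin hmax : ℝ} {Ω : Set (Eucl N)} {k : ℝ → ℝ} {h : Eucl N → ℝ}

/-- Dividing by ρ^p raises the exponent to N + sp > 0, so the lower bound decreases in ρ and is
smallest at r. -/
lemma IsKernel.le_div_rpow (hc₀ : 0 < c₀) (hp : 0 < p) (hs : 0 < s) (hk : IsKernel N p s c₀ δ k)
    {ρ r : ℝ} (hρ : 0 < ρ) (hρr : ρ < r) (hr : r ≤ δ) :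
    c₀ / r ^ ((N : ℝ) + s * p) ≤ k ρ / ρ ^ p := by
  have h1 := hk.lower_bound ρ hρ (hρr.trans_le hr)
  have h2 : (0 : ℝ) ≤ (N : ℝ) + s * p := by positivity
  calc c₀ / r ^ ((N : ℝ) + s * p) ≤ c₀ / ρ ^ ((N : ℝ) + s * p) := by gcongr
    _ = c₀ / ρ ^ ((N : ℝ) + (s - 1) * p) / ρ ^ p := by
      rw [div_div, ← Real.rpow_add hρ]; congr 2; ring
    _ ≤ k ρ / ρ ^ p := by gcongr

lemma integrable_abs_sub_rpow (hp : 1 < p) {μ : Measure (Eucl N)} [IsFiniteMeasure μ]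
    {v : Eucl N → ℝ} (hv : MemLp v (ENNReal.ofReal p) μ) :
    Integrable (fun z : Eucl N × Eucl N => |v z.2 - v z.1| ^ p) (μ.prod μ) := by
  have h1 := ((hv.comp_snd μ).sub (hv.comp_fst μ)).integrable_norm_rpow (by simp; linarith)
    ENNReal.ofReal_ne_top
  rw [ENNReal.toReal_ofReal (by linarith)] at h1
  exact h1

/-- Differences at distance less than `r` are controlled by the energy. -/
lemma setIntegral_abs_sub_rpow_le (hp : 1 < p) (hs : 0 < s) (hc₀ : 0 < c₀) (hΩ : IsOpen Ω)
    (hΩb : Bornology.IsBounded Ω) (hhmin : 0 < hmin) (hhmax : hmin < hmax)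
    (hk : IsKernel N p s c₀ δ k) (hh : IsCoefficient Ω δ hmin hmax h) {r : ℝ} (hr0 : 0 < r)
    (hr : r ≤ δ) {v : Eucl N → ℝ} (hv : v ∈ energySpaceZero Ω δ p k) :
    ∫ z in {z : Eucl N × Eucl N | ‖z.2 - z.1‖ < r}, |v z.2 - v z.1| ^ p
        ∂((extVol Ω δ).prod (extVol Ω δ)) ≤
      r ^ ((N : ℝ) + s * p) * (2 / (c₀ * hmin)) * form Ω δ p k h v v := by
  have := isFiniteMeasure_extVol (δ := δ) hΩb
  have hS : MeasurableSet {z : Eucl N × Eucl N | ‖z.2 - z.1‖ < r} :=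
    measurableSet_lt (measurable_snd.sub measurable_fst).norm measurable_const
  have hint := integrable_abs_sub_rpow (μ := extVol Ω δ) hp hv.1.1
  unfold form
  rw [← integral_indicator hS, ← integral_const_mul]
  refine integral_mono_ae (hint.indicator hS)
    ((integrable_form_self hp hΩ hhmin hhmax hk hh hv.1).const_mul _) ?_
  filter_upwards [hh.ae_prod hΩ hhmin hhmax, ae_prod_eq_zero_or hΩ hv.2] with z hz hz'
  have hp0 : 0 < p := by linarith
  have hw : 0 ≤ k ‖z.2 - z.1‖ / ‖z.2 - z.1‖ ^ p := div_nonneg (hk.nonneg _) (by positivity)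
  have hnn : 0 ≤ r ^ ((N : ℝ) + s * p) * (2 / (c₀ * hmin)) *
      formIntegrand p k (fun x' x => (h x' + h x) / 2) v v z := by
    rw [formIntegrand_self hp]
    exact mul_nonneg (by positivity) (mul_nonneg (mul_nonneg hz.1 hw) (by positivity))
  by_cases hzr : ‖z.2 - z.1‖ < r
  swap
  · rw [indicator_of_notMem (by exact hzr)]; exact hnn
  rcases hz' with h0 | h0
  · rw [indicator_of_mem (by exact hzr), h0, abs_zero, Real.zero_rpow hp0.ne']; exact hnn
  -- The kernel bound needs a positive distance; on the diagonal the increment is zero.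
  rcases (norm_nonneg (z.2 - z.1)).eq_or_lt with h1 | h1
  · have h2 : z.2 = z.1 := sub_eq_zero.1 (norm_eq_zero.1 h1.symm)
    rw [indicator_of_mem (by exact hzr), h2, sub_self, abs_zero, Real.zero_rpow hp0.ne']; exact hnn
  rw [indicator_of_mem (by exact hzr), formIntegrand_self hp]
  have h2 := hk.le_div_rpow hc₀ hp0 hs h1 hzr hr
  have h3 : hmin / 2 * (c₀ / r ^ ((N : ℝ) + s * p)) ≤
      (h z.2 + h z.1) / 2 * (k ‖z.2 - z.1‖ / ‖z.2 - z.1‖ ^ p) :=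
    mul_le_mul (hz.2.2 h0) h2 (by positivity) hz.1
  have h4 : 0 < r ^ ((N : ℝ) + s * p) := Real.rpow_pos_of_pos hr0 _
  calc |v z.2 - v z.1| ^ p = r ^ ((N : ℝ) + s * p) * (2 / (c₀ * hmin)) *
        (hmin / 2 * (c₀ / r ^ ((N : ℝ) + s * p)) * |v z.2 - v z.1| ^ p) := by field_simp
    _ ≤ _ := by gcongr

/-- Telescoping in steps of z; by translation invariance all n steps have the same norm. -/
lemma eLpNorm_translate_sub_le {q : ENNReal} (hq : 1 ≤ q) {w : Eucl N → ℝ} (hw : Measurable w)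
    (z : Eucl N) (n : ℕ) :
    eLpNorm (fun x => w (x + n • z) - w x) q volume ≤
      n * eLpNorm (fun x => w (x + z) - w x) q volume := by
  induction n with
  | zero => simp
  | succ n ih =>
    have hmeas : ∀ y : Eucl N, Measurable fun x => w (x + y) := fun y =>
      hw.comp (measurable_add_const y)
    have h1 : (fun x => w (x + (n + 1) • z) - w x) =
        (fun x => w (x + n • z + z) - w (x + n • z)) + fun x => w (x + n • z) - w x := by
      funext x
      simp only [Pi.add_apply, add_smul, one_smul, add_assoc]
      ring
    have h2 : eLpNorm (fun x => w (x + n • z + z) - w (x + n • z)) q volume =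
        eLpNorm (fun x => w (x + z) - w x) q volume :=
      eLpNorm_comp_measurePreserving (g := fun x => w (x + z) - w x)
        ((hmeas z).sub hw).aestronglyMeasurable (measurePreserving_add_right volume (n • z))
    rw [h1]
    refine (eLpNorm_add_le ?_ ?_ hq).trans ?_
    · exact (((hmeas z).sub hw).comp (measurable_add_const (n • z))).aestronglyMeasurable
    · exact ((hmeas _).sub hw).aestronglyMeasurable
    · rw [h2, Nat.cast_succ, add_mul, one_mul, add_comm]
      gcongr

/-- For x in Ω the point x + n z has left Ω, so the n-step increment at x is -w(x). -/
lemma lintegral_enorm_rpow_le_translate (hp : 1 < p) {w : Eucl N → ℝ} (hw : Measurable w)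
    (hw0 : ∀ x ∉ Ω, w x = 0) {z : Eucl N} {n : ℕ} (hz : ∀ x ∈ Ω, x + n • z ∉ Ω) :
    ∫⁻ x, ‖w x‖ₑ ^ p ≤ (n : ENNReal) ^ p * ∫⁻ x, ‖w (x + z) - w x‖ₑ ^ p := by
  have hp0 : 0 < p := by linarith
  have h1 : eLpNorm w (ENNReal.ofReal p) volume ≤
      eLpNorm (fun x => w (x + n • z) - w x) (ENNReal.ofReal p) volume := by
    refine eLpNorm_mono fun x => ?_
    by_cases hx : x ∈ Ω
    · rw [hw0 _ (hz x hx), zero_sub, norm_neg]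
    · rw [hw0 x hx, norm_zero]; exact norm_nonneg _
  have h2 := h1.trans (eLpNorm_translate_sub_le (by simpa using hp.le) hw z n)
  have h3 := ENNReal.rpow_le_rpow h2 hp0.le
  rw [ENNReal.mul_rpow_of_nonneg _ _ hp0.le] at h3
  simpa only [eLpNorm_eq_lintegral_rpow_enorm_toReal (ENNReal.ofReal_pos.2 hp0).ne'
    ENNReal.ofReal_ne_top, ENNReal.toReal_ofReal hp0.le, ← ENNReal.rpow_mul,
    one_div_mul_cancel hp0.ne', ENNReal.rpow_one] using h3

/-- Steps longer than δ/2 leave the bounded set Ω after a number n of steps that does not depend on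
z. -/
lemma exists_translate_notMem (hδ : 0 < δ) (hΩb : Bornology.IsBounded Ω) :
    ∃ n : ℕ, ∀ z : Eucl N, δ / 2 < ‖z‖ → ∀ x ∈ Ω, x + n • z ∉ Ω := by
  obtain ⟨R, hR⟩ := hΩb.subset_closedBall 0
  obtain ⟨n, hn⟩ := exists_nat_gt (2 * |R| / (δ / 2))
  refine ⟨n, fun z hz x hx hx' => ?_⟩
  have h1 := mem_closedBall_zero_iff.1 (hR hx)
  have h2 := mem_closedBall_zero_iff.1 (hR hx')
  rw [div_lt_iff₀ (by positivity)] at hn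
  have h3 : ‖n • z‖ ≤ 2 * |R| := by
    have := norm_sub_le (x + n • z) x
    rw [add_sub_cancel_left] at this
    linarith [le_abs_self R]
  rw [← Nat.cast_smul_eq_nsmul ℝ, norm_smul, Real.norm_natCast] at h3
  have : (n : ℝ) * (δ / 2) ≤ n * ‖z‖ := by gcongr
  linarith

lemma volume_annulus_pos (hN : 0 < N) (hδ : 0 < δ) :
    0 < volume {z : Eucl N | δ / 2 < ‖z‖ ∧ ‖z‖ < δ} := by
  refine IsOpen.measure_pos volume ?_ ?_
  · exact (isOpen_lt continuous_const continuous_norm).inter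
      (isOpen_lt continuous_norm continuous_const)
  · refine ⟨EuclideanSpace.single ⟨0, hN⟩ (3 * δ / 4), ?_⟩
    simp only [mem_ofPred_eq, PiLp.norm_single, Real.norm_eq_abs]
    rw [abs_of_pos (by positivity)]
    constructor <;> linarith

/-- The nonlocal Poincaré inequality on `X₀`. -/
lemma exists_poincare (hN : 0 < N) (hp : 1 < p) (hs : 0 < s) (hc₀ : 0 < c₀) (hδ : 0 < δ)
    (hΩ : IsOpen Ω) (hΩb : Bornology.IsBounded Ω) (hhmin : 0 < hmin) (hhmax : hmin < hmax)
    (hk : IsKernel N p s c₀ δ k) (hh : IsCoefficient Ω δ hmin hmax h) :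
    ∃ C : ℝ, 0 ≤ C ∧ ∀ v ∈ energySpaceZero Ω δ p k,
      ∫ x, |v x| ^ p ∂(extVol Ω δ) ≤ C * form Ω δ p k h v v := by
  have hp0 : 0 < p := by linarith
  have := isFiniteMeasure_extVol (δ := δ) hΩb
  obtain ⟨n, hn⟩ := exists_translate_notMem hδ hΩb
  -- The inner radius bounds the number of steps needed to leave Ω; the outer radius keeps each step
  -- within the horizon.
  set A : Set (Eucl N) := {z | δ / 2 < ‖z‖ ∧ ‖z‖ < δ} with hA
  have hAm : MeasurableSet A := (measurableSet_lt measurable_const measurable_norm).inter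
    (measurableSet_lt measurable_norm measurable_const)
  have hA0 : 0 < volume A := volume_annulus_pos hN hδ
  have hA1 : volume A ≠ ⊤ := ((Metric.isBounded_ball (x := (0 : Eucl N)) (r := δ)).subset
    fun z hz => mem_ball_zero_iff.2 hz.2).measure_lt_top.ne
  have hAr : 0 < (volume A).toReal := ENNReal.toReal_pos hA0.ne' hA1
  set D : ℝ := δ ^ ((N : ℝ) + s * p) * (2 / (c₀ * hmin)) with hD
  refine ⟨(n : ℝ) ^ p * D / (volume A).toReal, by positivity, fun v hv => ?_⟩
  set S : Set (Eucl N × Eucl N) := {z | ‖z.2 - z.1‖ < δ} with hS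
  have hSm : MeasurableSet S :=
    measurableSet_lt (measurable_snd.sub measurable_fst).norm measurable_const
  -- A measurable representative vanishing everywhere off Ω, so that translations can be made in all
  -- of ℝ^N.
  set w : Eucl N → ℝ := Ω.indicator (hv.1.1.1.mk v) with hw
  have hwm : Measurable w := hv.1.1.1.stronglyMeasurable_mk.measurable.indicator hΩ.measurableSet
  have hw0 : ∀ x ∉ Ω, w x = 0 := fun x hx => indicator_of_notMem hx _
  have hwv : ∀ᵐ x ∂(extVol Ω δ), v x = w x := by
    filter_upwards [hv.1.1.1.ae_eq_mk, ae_extVol_imp_of_collar hΩ hv.2] with x h1 h2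
    by_cases hx : x ∈ Ω
    · rw [hw, indicator_of_mem hx, h1]
    · rw [hw0 x hx, h2 hx]
  have hEv := form_self_nonneg hp hΩ hhmin hhmax hk hh v
  have henorm : ∀ t : ℝ, ‖t‖ₑ ^ p = ENNReal.ofReal (|t| ^ p) := fun t => by
    rw [← ofReal_norm, ENNReal.ofReal_rpow_of_nonneg (norm_nonneg _) hp0.le, Real.norm_eq_abs]
  have hG : Measurable fun z : Eucl N × Eucl N => ‖w z.2 - w z.1‖ₑ ^ p :=
    ((hwm.comp measurable_snd).sub (hwm.comp measurable_fst)).enorm.pow_const p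
  -- Fubini and y = x + z give a double integral over pairs with y - x in A; a nonzero increment has
  -- a point in Ω, so both points lie in Ω_δ.
  have hinner : ∫⁻ z in A, ∫⁻ x, ‖w (x + z) - w x‖ₑ ^ p ≤
      ∫⁻ z in S, ‖w z.2 - w z.1‖ₑ ^ p ∂((extVol Ω δ).prod (extVol Ω δ)) := by
    calc ∫⁻ z in A, ∫⁻ x, ‖w (x + z) - w x‖ₑ ^ p
        = ∫⁻ z, ∫⁻ x, A.indicator 1 z * ‖w (x + z) - w x‖ₑ ^ p := by
          rw [← lintegral_indicator hAm]
          refine lintegral_congr fun z => ?_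
          by_cases hz : z ∈ A <;> simp [hz]
      _ = ∫⁻ x, ∫⁻ z, A.indicator 1 z * ‖w (x + z) - w x‖ₑ ^ p := by
          refine lintegral_lintegral_swap (Measurable.aemeasurable ?_)
          refine ((measurable_one.indicator hAm).comp measurable_fst).mul ?_
          exact ((hwm.comp (measurable_snd.add measurable_fst)).sub
            (hwm.comp measurable_snd)).enorm.pow_const p
      _ = ∫⁻ x, ∫⁻ y, A.indicator 1 (y - x) * ‖w y - w x‖ₑ ^ p := by
          refine lintegral_congr fun x => ?_
          rw [← lintegral_add_left_eq_self (μ := volume)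
            (fun y => A.indicator 1 (y - x) * ‖w y - w x‖ₑ ^ p) x]
          simp
      _ = ∫⁻ z : Eucl N × Eucl N, A.indicator 1 (z.2 - z.1) * ‖w z.2 - w z.1‖ₑ ^ p
            ∂(volume.prod volume) := by
          rw [lintegral_prod _ (Measurable.aemeasurable ?_)]
          exact ((measurable_one.indicator hAm).comp (measurable_snd.sub measurable_fst)).mul hG
      _ ≤ ∫⁻ z in S ∩ (extendedDomain Ω δ ×ˢ extendedDomain Ω δ), ‖w z.2 - w z.1‖ₑ ^ p
            ∂(volume.prod volume) := by
          have hE := (isOpen_extendedDomain (δ := δ) hΩ).measurableSet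
          rw [← lintegral_indicator (hSm.inter (hE.prod hE))]
          refine lintegral_mono fun z => ?_
          by_cases hz : z.2 - z.1 ∈ A
          swap
          · simp [hz]
          have hzS : ‖z.2 - z.1‖ < δ := hz.2
          by_cases h1 : z.1 ∈ Ω ∨ z.2 ∈ Ω
          · have hmem : z ∈ S ∩ (extendedDomain Ω δ ×ˢ extendedDomain Ω δ) := by
              refine ⟨hzS, ?_⟩
              rcases h1 with h1 | h1
              · exact ⟨subset_extendedDomain h1,
                  mem_extendedDomain_of_dist_lt hΩ h1 (by rwa [dist_comm, dist_eq_norm])⟩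
              · exact ⟨mem_extendedDomain_of_dist_lt hΩ h1 (by rwa [dist_eq_norm]),
                  subset_extendedDomain h1⟩
            rw [indicator_of_mem hmem, indicator_of_mem hz, Pi.one_apply, one_mul]
          · push Not at h1
            simp [hw0 _ h1.1, hw0 _ h1.2, hp0]
      _ = ∫⁻ z in S, ‖w z.2 - w z.1‖ₑ ^ p ∂((extVol Ω δ).prod (extVol Ω δ)) := by
          rw [extVol, Measure.prod_restrict, Measure.restrict_restrict hSm]
  have hS2 : ∫⁻ z in S, ‖w z.2 - w z.1‖ₑ ^ p ∂((extVol Ω δ).prod (extVol Ω δ)) ≤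
      ENNReal.ofReal (D * form Ω δ p k h v v) := by
    have h1 := setIntegral_abs_sub_rpow_le hp hs hc₀ hΩ hΩb hhmin hhmax hk hh hδ le_rfl hv
    refine le_trans (le_of_eq ?_) (ENNReal.ofReal_le_ofReal h1)
    rw [ofReal_integral_eq_lintegral_ofReal
      (integrable_abs_sub_rpow (μ := extVol Ω δ) hp hv.1.1).integrableOn
      (Eventually.of_forall fun _ => by positivity)]
    refine lintegral_congr_ae (ae_restrict_of_ae ?_)
    filter_upwards [Measure.quasiMeasurePreserving_fst.ae hwv,
      Measure.quasiMeasurePreserving_snd.ae hwv] with z h1 h2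
    rw [h1, h2, henorm]
  have hmain : volume A * ∫⁻ x, ‖w x‖ₑ ^ p ≤
      (n : ENNReal) ^ p * ENNReal.ofReal (D * form Ω δ p k h v v) := by
    calc volume A * ∫⁻ x, ‖w x‖ₑ ^ p = ∫⁻ _ in A, ∫⁻ x, ‖w x‖ₑ ^ p := by
          rw [setLIntegral_const, mul_comm]
      _ ≤ ∫⁻ z in A, (n : ENNReal) ^ p * ∫⁻ x, ‖w (x + z) - w x‖ₑ ^ p :=
          setLIntegral_mono' hAm fun z hz =>
            lintegral_enorm_rpow_le_translate hp hwm hw0 (hn z hz.1)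
      _ = (n : ENNReal) ^ p * ∫⁻ z in A, ∫⁻ x, ‖w (x + z) - w x‖ₑ ^ p :=
          lintegral_const_mul' _ _ (ENNReal.rpow_ne_top_of_nonneg hp0.le (by simp))
      _ ≤ _ := by gcongr; exact hinner.trans hS2
  have hvw : ENNReal.ofReal (∫ x, |v x| ^ p ∂(extVol Ω δ)) ≤ ∫⁻ x, ‖w x‖ₑ ^ p := by
    have hi := hv.1.1.integrable_norm_rpow (by simpa using hp0) ENNReal.ofReal_ne_top
    simp only [ENNReal.toReal_ofReal hp0.le, Real.norm_eq_abs] at hi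
    rw [ofReal_integral_eq_lintegral_ofReal hi (Eventually.of_forall fun _ => by positivity)]
    refine le_trans (le_of_eq ?_) (setLIntegral_le_lintegral (extendedDomain Ω δ) _)
    refine lintegral_congr_ae (hwv.mono fun x hx => ?_)
    simp only [hx, henorm]
  have hfin : ENNReal.ofReal ((volume A).toReal * ∫ x, |v x| ^ p ∂(extVol Ω δ)) ≤
      ENNReal.ofReal ((n : ℝ) ^ p * (D * form Ω δ p k h v v)) := by
    rw [ENNReal.ofReal_mul hAr.le, ENNReal.ofReal_toReal hA1, ENNReal.ofReal_mul (by positivity),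
      ← ENNReal.ofReal_rpow_of_nonneg (by positivity) hp0.le, ENNReal.ofReal_natCast]
    exact (by gcongr : _ ≤ volume A * ∫⁻ x, ‖w x‖ₑ ^ p).trans hmain
  rw [ENNReal.ofReal_le_ofReal_iff (by positivity)] at hfin
  rw [div_mul_eq_mul_div, le_div_iff₀ hAr]
  linarith

end Poincare

/-! ### Hölder duality and boundedness of weakly convergent sequences. -/

section Holder

variable {α : Type*} [MeasurableSpace α] {μ : Measure α} {p q : ℝ}

lemma MemLp_integrable_abs_rpow (hp : 0 < p) {f : α → ℝ} (hf : MemLp f (ENNReal.ofReal p) μ) :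
    Integrable (fun x => |f x| ^ p) μ := by
  have h := hf.integrable_norm_rpow (ENNReal.ofReal_pos.2 hp).ne' ENNReal.ofReal_ne_top
  simpa only [ENNReal.toReal_ofReal hp.le, Real.norm_eq_abs] using h

lemma integrable_mul_of_holderConjugate (hqp : q.HolderConjugate p) {f g : α → ℝ}
    (hf : MemLp f (ENNReal.ofReal q) μ) (hg : MemLp g (ENNReal.ofReal p) μ) :
    Integrable (fun x => f x * g x) μ := by
  have := hqp.ennrealOfReal
  exact hf.integrable_mul hg

lemma abs_integral_mul_le_Lp_mul_Lq (hqp : q.HolderConjugate p) {f g : α → ℝ}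
    (hf : MemLp f (ENNReal.ofReal q) μ) (hg : MemLp g (ENNReal.ofReal p) μ) :
    |∫ x, f x * g x ∂μ| ≤ (∫ x, |f x| ^ q ∂μ) ^ (1 / q) * (∫ x, |g x| ^ p ∂μ) ^ (1 / p) := by
  refine (abs_integral_le_integral_abs).trans ?_
  simpa only [abs_mul, Real.norm_eq_abs] using integral_mul_norm_le_Lp_mul_Lq hqp hf hg

lemma eLpNorm_ofReal_eq (hp : 0 < p) {f : α → ℝ} (hf : MemLp f (ENNReal.ofReal p) μ) :
    eLpNorm f (ENNReal.ofReal p) μ = ENNReal.ofReal ((∫ x, |f x| ^ p ∂μ) ^ (1 / p)) := by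
  rw [hf.eLpNorm_eq_integral_rpow_norm (ENNReal.ofReal_pos.2 hp).ne' ENNReal.ofReal_ne_top]
  simp only [ENNReal.toReal_ofReal hp.le, Real.norm_eq_abs, one_div]

/-- A sequence in `L^q` whose pairing with each element of `L^p` is bounded is bounded in `L^q`. -/
lemma exists_integral_abs_rpow_le (hqp : q.HolderConjugate p) {f : ℕ → α → ℝ}
    (hf : ∀ j, MemLp (f j) (ENNReal.ofReal q) μ)
    (hbdd : ∀ φ : α → ℝ, MemLp φ (ENNReal.ofReal p) μ → ∃ C, ∀ j, |∫ x, f j x * φ x ∂μ| ≤ C) :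
    ∃ M : ℝ, 0 ≤ M ∧ ∀ j, ∫ x, |f j x| ^ q ∂μ ≤ M := by
  have := hqp.ennrealOfReal
  have : Fact (1 ≤ ENNReal.ofReal q) := ⟨ENNReal.one_le_ofReal.2 hqp.lt.le⟩
  have : Fact (1 ≤ ENNReal.ofReal p) := ⟨ENNReal.one_le_ofReal.2 hqp.symm.lt.le⟩
  let T : ℕ → Lp ℝ (ENNReal.ofReal p) μ →L[ℝ] ℝ := fun j =>
    (ContinuousLinearMap.mul ℝ ℝ).lpPairing μ (ENNReal.ofReal q) (ENNReal.ofReal p) ((hf j).toLp _)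
  have hT : ∀ j φ, T j φ = ∫ x, f j x * φ x ∂μ := fun j φ => by
    simp only [T, ContinuousLinearMap.lpPairing_eq_integral]
    refine integral_congr_ae ?_
    filter_upwards [(hf j).coeFn_toLp] with x hx
    simp [hx]
  obtain ⟨C, hC⟩ := banach_steinhaus (g := T) fun φ => by
    obtain ⟨C, hC⟩ := hbdd φ (Lp.memLp φ)
    exact ⟨C, fun j => by rw [hT, Real.norm_eq_abs]; exact hC j⟩
  have hC0 : 0 ≤ C := (norm_nonneg _).trans (hC 0)
  have hp0 := hqp.symm.pos
  have hq0 := hqp.pos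
  refine ⟨C ^ q, by positivity, fun j => ?_⟩
  set I := ∫ x, |f j x| ^ q ∂μ with hI
  have hI0 : 0 ≤ I := integral_nonneg fun x => by positivity
  -- The extremal function in Hölder's inequality: (q - 1)p = q gives |φ|^p = |f_j|^q, and the
  -- pairing with f_j is I.
  set φ : α → ℝ := fun x => |f j x| ^ (q - 2) * f j x with hφ
  have hpow : ∀ x, |φ x| ^ p = |f j x| ^ q := fun x => by
    rw [hφ, abs_abs_rpow_sub_two_mul hqp.lt, ← Real.rpow_mul (abs_nonneg _),
      hqp.sub_one_mul_conj]
  have hφm : AEStronglyMeasurable φ μ :=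
    (((hf j).1.norm.aemeasurable.pow_const _).mul (hf j).1.aemeasurable).aestronglyMeasurable
  have hφL : MemLp φ (ENNReal.ofReal p) μ := by
    rw [← integrable_norm_rpow_iff hφm (ENNReal.ofReal_pos.2 hp0).ne' ENNReal.ofReal_ne_top]
    simp only [ENNReal.toReal_ofReal hp0.le, Real.norm_eq_abs, hpow]
    exact MemLp_integrable_abs_rpow hq0 (hf j)
  have h1 : T j (hφL.toLp φ) = I := by
    rw [hT]
    refine integral_congr_ae ?_
    filter_upwards [hφL.coeFn_toLp] with x hx
    rw [hx, hφ, mul_comm]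
    exact abs_rpow_sub_two_mul_self_mul_self hqp.lt _
  have h2 : ‖hφL.toLp φ‖ = I ^ (1 / p) := by
    rw [Lp.norm_toLp, eLpNorm_ofReal_eq hp0 hφL, ENNReal.toReal_ofReal (by positivity)]
    simp only [hpow, hI]
  have h3 : I ≤ C * I ^ (1 / p) := by
    rw [← h2]
    nth_rw 1 [← h1]
    exact (le_abs_self _).trans ((T j).le_of_opNorm_le (hC j) _)
  rcases hI0.eq_or_lt with h0 | h0
  · rw [← h0]; positivity
  · have h4 : I ^ (1 / q) ≤ C := by
      have h5 : I ^ (1 / q) * I ^ (1 / p) = I := by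
        rw [← Real.rpow_add h0, one_div, one_div, hqp.inv_add_inv_eq_one, Real.rpow_one]
      have h6 : 0 < I ^ (1 / p) := by positivity
      exact le_of_mul_le_mul_right (h5.le.trans h3) h6
    calc I = (I ^ (1 / q)) ^ q := by
          rw [← Real.rpow_mul hI0, one_div_mul_cancel hq0.ne', Real.rpow_one]
      _ ≤ C ^ q := by gcongr

end Holder

/-! ### Weak convergence of sources implies convergence in the dual of X₀. -/

section DualCompactness

variable {N : ℕ} {p q s c₀ δ hmin hmax : ℝ} {Ω : Set (Eucl N)} {k : ℝ → ℝ} {h : Eucl N → ℝ}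

lemma measurableSet_dist_lt (r : ℝ) : MeasurableSet {z : Eucl N × Eucl N | ‖z.2 - z.1‖ < r} :=
  measurableSet_lt (measurable_snd.sub measurable_fst).norm measurable_const

/-- For x in Ω and r ≤ δ the whole ball B(x, r) lies in Ω_δ, so each section has the measure of a
full ball. -/
lemma setIntegral_fst_eq (hΩ : IsOpen Ω) (hΩb : Bornology.IsBounded Ω) {r : ℝ} (hr : r ≤ δ)
    {G : Eucl N → ℝ} (hG : Integrable G (volume.restrict Ω)) :
    ∫ z in {z : Eucl N × Eucl N | ‖z.2 - z.1‖ < r}, G z.1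
        ∂((volume.restrict Ω).prod (extVol Ω δ)) =
      volume.real (Metric.ball (0 : Eucl N) r) * ∫ x in Ω, G x := by
  have := isFiniteMeasure_extVol (δ := δ) hΩb
  have hS := measurableSet_dist_lt (N := N) r
  rw [← integral_indicator hS, integral_prod _ ((hG.comp_fst _).indicator hS),
    ← integral_const_mul]
  refine setIntegral_congr_fun hΩ.measurableSet fun x hx => ?_
  have h1 : (fun y => {z : Eucl N × Eucl N | ‖z.2 - z.1‖ < r}.indicator (fun z => G z.1) (x, y)) =
      (Metric.ball x r).indicator fun _ => G x := by
    funext y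
    simp only [indicator, mem_ofPred_eq, Metric.mem_ball, dist_eq_norm]
  simp only [h1]
  rw [integral_indicator Metric.isOpen_ball.measurableSet, setIntegral_const, smul_eq_mul]
  congr 1
  rw [extVol, measureReal_restrict_apply Metric.isOpen_ball.measurableSet, inter_eq_left.2,
    measureReal_def, Measure.addHaar_ball_center, measureReal_def]
  intro y hy
  exact mem_extendedDomain_of_dist_lt hΩ hx ((Metric.mem_ball'.1 hy).trans_le hr)

lemma setIntegral_mul_snd_eq (hΩb : Bornology.IsBounded Ω) {r : ℝ}
    {f w : Eucl N → ℝ} (hf : Integrable f (volume.restrict Ω)) (hw : Integrable w (extVol Ω δ)) :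
    ∫ z in {z : Eucl N × Eucl N | ‖z.2 - z.1‖ < r}, f z.1 * w z.2
        ∂((volume.restrict Ω).prod (extVol Ω δ)) =
      ∫ y, (∫ x in Metric.ball y r, f x ∂(volume.restrict Ω)) * w y ∂(extVol Ω δ) := by
  have := isFiniteMeasure_extVol (δ := δ) hΩb
  have hS := measurableSet_dist_lt (N := N) r
  rw [← integral_indicator hS, integral_prod_symm _ ((hf.mul_prod hw).indicator hS)]
  refine integral_congr_ae (Eventually.of_forall fun y => ?_)
  have h1 : (fun x => {z : Eucl N × Eucl N | ‖z.2 - z.1‖ < r}.indicator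
      (fun z => f z.1 * w z.2) (x, y)) = (Metric.ball y r).indicator fun x => f x * w y := by
    funext x
    simp only [indicator, mem_ofPred_eq, Metric.mem_ball, dist_eq_norm, norm_sub_rev x y]
  simp only [h1]
  rw [integral_indicator Metric.isOpen_ball.measurableSet, integral_mul_const]

lemma memLp_ball_integral (hΩb : Bornology.IsBounded Ω) {r : ℝ}
    {f : Eucl N → ℝ} (hf : Integrable f (volume.restrict Ω)) (Q : ENNReal) :
    MemLp (fun y => ∫ x in Metric.ball y r, f x ∂(volume.restrict Ω)) Q (extVol Ω δ) := by
  have := isFiniteMeasure_extVol (δ := δ) hΩb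
  refine MemLp.of_bound ?_ (∫ x in Ω, |f x|) (Eventually.of_forall fun y => ?_)
  · have h1 : AEStronglyMeasurable ({z : Eucl N × Eucl N | ‖z.2 - z.1‖ < r}.indicator
        fun z => f z.2) ((extVol Ω δ).prod (volume.restrict Ω)) :=
      (hf.1.comp_snd).indicator (measurableSet_dist_lt r)
    refine h1.integral_prod_right'.congr (Eventually.of_forall fun y => ?_)
    simp only [← integral_indicator Metric.isOpen_ball.measurableSet]
    refine integral_congr_ae (Eventually.of_forall fun x => ?_)
    simp only [indicator, mem_ofPred_eq, Metric.mem_ball, dist_eq_norm]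
  · refine (norm_integral_le_integral_norm _).trans ?_
    exact setIntegral_le_integral hf.norm (Eventually.of_forall fun _ => norm_nonneg _)

/-- The pairing of `f` with an element of `X₀` is estimated by the averages of `f` on balls. -/
lemma dual_estimate (hqp : q.HolderConjugate p) (hs : 0 < s) (hc₀ : 0 < c₀)
    (hΩ : IsOpen Ω) (hΩb : Bornology.IsBounded Ω) (hhmin : 0 < hmin) (hhmax : hmin < hmax)
    (hk : IsKernel N p s c₀ δ k) (hh : IsCoefficient Ω δ hmin hmax h) {r : ℝ} (hr0 : 0 < r)
    (hr : r ≤ δ) {f w : Eucl N → ℝ} (hf : MemLp f (ENNReal.ofReal q) (volume.restrict Ω))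
    (hw : w ∈ energySpaceZero Ω δ p k) :
    volume.real (Metric.ball (0 : Eucl N) r) * |∫ x in Ω, f x * w x| ≤
      (volume.real (Metric.ball (0 : Eucl N) r) * ∫ x in Ω, |f x| ^ q) ^ (1 / q) *
        (r ^ ((N : ℝ) + s * p) * (2 / (c₀ * hmin)) * form Ω δ p k h w w) ^ (1 / p) +
      (∫ y, |∫ x in Metric.ball y r, f x ∂(volume.restrict Ω)| ^ q ∂(extVol Ω δ)) ^ (1 / q) *
        (∫ x, |w x| ^ p ∂(extVol Ω δ)) ^ (1 / p) := by
  have := isFiniteMeasure_extVol (δ := δ) hΩb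
  have : IsFiniteMeasure (volume.restrict Ω) := ⟨by
    rw [Measure.restrict_apply_univ]; exact hΩb.measure_lt_top⟩
  have hp1 := hqp.symm.lt
  set S : Set (Eucl N × Eucl N) := {z | ‖z.2 - z.1‖ < r} with hSdef
  set ν : Measure (Eucl N) := volume.restrict Ω with hν
  set μ := extVol Ω δ with hμ
  have hνμ : ν ≤ μ := volume_restrict_le_extVol
  have hwν : MemLp w (ENNReal.ofReal p) ν := hw.1.1.mono_measure hνμ
  have hf1 : Integrable f ν := hf.integrable (ENNReal.one_le_ofReal.2 hqp.lt.le)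
  have hw1 : Integrable w μ := hw.1.1.integrable (ENNReal.one_le_ofReal.2 hp1.le)
  have hfw := integrable_mul_of_holderConjugate hqp hf hwν
  have e1 := setIntegral_fst_eq hΩ hΩb hr hfw
  have e2 := setIntegral_fst_eq (δ := δ) hΩ hΩb hr (MemLp_integrable_abs_rpow hqp.pos hf)
  have e3 := setIntegral_mul_snd_eq (δ := δ) (r := r) hΩb hf1 hw1
  have hF : MemLp (fun z : Eucl N × Eucl N => f z.1) (ENNReal.ofReal q)
      ((ν.prod μ).restrict S) := (hf.comp_fst μ).restrict S
  have hW : MemLp (fun z : Eucl N × Eucl N => w z.1 - w z.2) (ENNReal.ofReal p)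
      ((ν.prod μ).restrict S) := ((hwν.comp_fst μ).sub (hw.1.1.comp_snd ν)).restrict S
  have h1 := abs_integral_mul_le_Lp_mul_Lq hqp hF hW
  have h2 := abs_integral_mul_le_Lp_mul_Lq hqp (memLp_ball_integral (r := r) hΩb hf1 _) hw.1.1
  rw [e2] at h1
  have h3 : ∫ z in S, |w z.1 - w z.2| ^ p ∂(ν.prod μ) ≤
      r ^ ((N : ℝ) + s * p) * (2 / (c₀ * hmin)) * form Ω δ p k h w w := by
    refine le_trans ?_
      (setIntegral_abs_sub_rpow_le hp1 hs hc₀ hΩ hΩb hhmin hhmax hk hh hr0 hr hw)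
    simp only [fun z : Eucl N × Eucl N => abs_sub_comm (w z.1) (w z.2)]
    refine integral_mono_measure (Measure.restrict_mono le_rfl (Measure.prod_mono hνμ le_rfl))
      (Eventually.of_forall fun _ => by positivity)
      (integrable_abs_sub_rpow hp1 hw.1.1).integrableOn
  -- Integrates f(x)w(x) = f(x)(w(x) - w(y)) + f(x)w(y) over |x - y| < r.
  have h4 : (∫ z in S, f z.1 * (w z.1 - w z.2) ∂(ν.prod μ)) +
      ∫ z in S, f z.1 * w z.2 ∂(ν.prod μ) =
      volume.real (Metric.ball (0 : Eucl N) r) * ∫ x, f x * w x ∂ν := by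
    rw [← e1, ← integral_add (integrable_mul_of_holderConjugate hqp hF hW)
      (hf1.mul_prod hw1).integrableOn]
    refine integral_congr_ae (Eventually.of_forall fun z => ?_)
    simp only
    ring
  rw [e3] at h4
  rw [← abs_of_nonneg (measureReal_nonneg (μ := volume) (s := Metric.ball (0 : Eucl N) r)),
    ← abs_mul, ← h4, abs_of_nonneg measureReal_nonneg]
  refine (abs_add_le _ _).trans (add_le_add (h1.trans ?_) h2)
  gcongr

/-- Weak convergence tested on ball indicators gives pointwise convergence; the L^q bound gives a
uniform bound, and dominated convergence applies since Ω_δ has finite measure. -/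
lemma tendsto_ball_integral (hqp : q.HolderConjugate p) (hΩb : Bornology.IsBounded Ω)
    {f : ℕ → Eucl N → ℝ} (hf : ∀ j, MemLp (f j) (ENNReal.ofReal q) (volume.restrict Ω))
    (hweak : WeaklyConverges Ω p f 0) {M : ℝ} (hM : ∀ j, ∫ x in Ω, |f j x| ^ q ≤ M) (r : ℝ) :
    Tendsto (fun j => ∫ y, |∫ x in Metric.ball y r, f j x ∂(volume.restrict Ω)| ^ q
      ∂(extVol Ω δ)) atTop (𝓝 0) := by
  have := isFiniteMeasure_extVol (δ := δ) hΩb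
  have : IsFiniteMeasure (volume.restrict Ω) := ⟨by
    rw [Measure.restrict_apply_univ]; exact hΩb.measure_lt_top⟩
  have hq0 := hqp.pos
  have hball : ∀ (j : ℕ) (y : Eucl N), ∫ x in Metric.ball y r, f j x ∂(volume.restrict Ω) =
      ∫ x in Ω, f j x * (Metric.ball y r).indicator (fun _ => (1 : ℝ)) x := fun j y => by
    rw [← integral_indicator Metric.isOpen_ball.measurableSet]
    refine integral_congr_ae (Eventually.of_forall fun x => ?_)
    by_cases hx : x ∈ Metric.ball y r <;> simp [hx]
  have hφ : ∀ y : Eucl N, MemLp ((Metric.ball y r).indicator fun _ => (1 : ℝ))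
      (ENNReal.ofReal p) (volume.restrict Ω) := fun y =>
    (memLp_const 1).indicator Metric.isOpen_ball.measurableSet
  set B : ℝ := M ^ (1 / q) * (volume.real Ω) ^ (1 / p) with hB
  have hbound : ∀ (j : ℕ) (y : Eucl N),
      |∫ x in Metric.ball y r, f j x ∂(volume.restrict Ω)| ≤ B := fun j y => by
    rw [hball]
    refine (abs_integral_mul_le_Lp_mul_Lq hqp (hf j) (hφ y)).trans ?_
    have h0 : 0 ≤ ∫ x in Ω, |f j x| ^ q := integral_nonneg fun _ => by positivity
    have h1 : ∫ x in Ω, |(Metric.ball y r).indicator (fun _ => (1 : ℝ)) x| ^ p ≤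
        volume.real Ω := by
      refine (integral_mono_of_nonneg (g := fun _ => (1 : ℝ))
        (Eventually.of_forall fun _ => by positivity) (integrable_const 1)
        (Eventually.of_forall fun x => ?_)).trans_eq (by simp)
      by_cases hx : x ∈ Metric.ball y r <;> simp [hx, hqp.symm.ne_zero]
    have h2 : 0 ≤ ∫ x in Ω, |(Metric.ball y r).indicator (fun _ => (1 : ℝ)) x| ^ p :=
      integral_nonneg fun _ => by positivity
    have := hqp.symm.pos
    have := h0.trans (hM j)
    rw [hB]
    gcongr
    exact hM j
  have hlim : ∀ y : Eucl N, Tendsto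
      (fun j => |∫ x in Metric.ball y r, f j x ∂(volume.restrict Ω)| ^ q) atTop (𝓝 0) := by
    intro y
    have h1 := hweak _ (hφ y)
    simp only [Pi.zero_apply, zero_mul, integral_zero, ← hball] at h1
    simpa [Real.zero_rpow hq0.ne'] using h1.abs.rpow_const (p := q) (Or.inr hq0.le)
  have hdct := tendsto_integral_of_dominated_convergence (μ := extVol Ω δ) (fun _ => B ^ q)
    (F := fun j y => |∫ x in Metric.ball y r, f j x ∂(volume.restrict Ω)| ^ q) (f := fun _ => 0)
    (fun j => (MemLp_integrable_abs_rpow hq0 (memLp_ball_integral hΩb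
      ((hf j).integrable (ENNReal.one_le_ofReal.2 hqp.lt.le)) _)).1) (integrable_const _)
    (fun j => Eventually.of_forall fun y => by
      rw [Real.norm_of_nonneg (by positivity)]
      gcongr
      exact hbound j y) (Eventually.of_forall hlim)
  simpa using hdct

/-- A weakly null sequence in `L^{p'}(Ω)` converges to zero in the norm of the dual of `X₀`. -/
lemma eventually_abs_integral_mul_le (hN : 0 < N) (hqp : q.HolderConjugate p) (hs : 0 < s)
    (hc₀ : 0 < c₀) (hδ : 0 < δ) (hΩ : IsOpen Ω) (hΩb : Bornology.IsBounded Ω) (hhmin : 0 < hmin)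
    (hhmax : hmin < hmax) (hk : IsKernel N p s c₀ δ k) (hh : IsCoefficient Ω δ hmin hmax h)
    {f : ℕ → Eucl N → ℝ} (hf : ∀ j, MemLp (f j) (ENNReal.ofReal q) (volume.restrict Ω))
    (hweak : WeaklyConverges Ω p f 0) {ε : ℝ} (hε : 0 < ε) :
    ∀ᶠ j in atTop, ∀ w ∈ energySpaceZero Ω δ p k,
      |∫ x in Ω, f j x * w x| ≤ ε * form Ω δ p k h w w ^ (1 / p) := by
  have hp0 := hqp.symm.pos
  have hq0 := hqp.pos
  have hp1 := hqp.symm.lt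
  obtain ⟨M, hM0, hM⟩ := exists_integral_abs_rpow_le hqp hf fun φ hφ => by
    have h1 := hweak φ hφ
    simp only [Pi.zero_apply, zero_mul, integral_zero] at h1
    obtain ⟨C, hC⟩ := h1.abs.bddAbove_range
    exact ⟨C, fun j => hC (mem_range_self j)⟩
  obtain ⟨C, hC0, hC⟩ := exists_poincare hN hp1 hs hc₀ hδ hΩ hΩb hhmin hhmax hk hh
  have : Nonempty (Fin N) := ⟨⟨0, hN⟩⟩
  set b₁ := volume.real (Metric.ball (0 : Eucl N) 1) with hb₁
  have hb₁0 : 0 < b₁ :=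
    ENNReal.toReal_pos (Metric.measure_ball_pos volume 0 one_pos).ne' measure_ball_lt_top.ne
  have hb : ∀ r : ℝ, 0 < r → volume.real (Metric.ball (0 : Eucl N) r) = r ^ (N : ℝ) * b₁ := by
    intro r hr
    rw [measureReal_def, Measure.addHaar_ball _ _ hr.le, ENNReal.toReal_mul,
      ENNReal.toReal_ofReal (by positivity), finrank_euclideanSpace_fin, Real.rpow_natCast]
    rfl
  -- After division by |B_r| = r^N b₁ the increment term keeps the factor (r^(sp))^(1/p), which
  -- tends to 0 with r. The radius is fixed before j.
  obtain ⟨r, hr0, hrδ, hr⟩ : ∃ r : ℝ, 0 < r ∧ r ≤ δ ∧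
      M ^ (1 / q) * (r ^ (s * p) * (2 / (c₀ * hmin) / b₁)) ^ (1 / p) ≤ ε / 2 := by
    have hcont : Continuous fun r : ℝ =>
        M ^ (1 / q) * (r ^ (s * p) * (2 / (c₀ * hmin) / b₁)) ^ (1 / p) := by
      refine continuous_const.mul (Continuous.rpow_const (Continuous.mul
        (Real.continuous_rpow_const (by positivity)) continuous_const)
        fun _ => Or.inr (by positivity))
    have h0 := hcont.tendsto 0
    simp only [Real.zero_rpow (mul_pos hs hp0).ne', zero_mul,
      Real.zero_rpow (one_div_pos.2 hp0).ne', mul_zero] at h0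
    have h1 := (h0.mono_left (nhdsWithin_le_nhds (s := Ioi 0))).eventually (Iic_mem_nhds (half_pos hε))
    obtain ⟨r, hr, hr'⟩ := (h1.and (Ioc_mem_nhdsGT hδ)).exists
    exact ⟨r, hr'.1, hr'.2, hr⟩
  set b := volume.real (Metric.ball (0 : Eucl N) r) with hbdef
  have hb0 : 0 < b := by rw [hbdef, hb r hr0]; positivity
  have hsmall : ∀ᶠ j in atTop,
      (∫ y, |∫ x in Metric.ball y r, f j x ∂(volume.restrict Ω)| ^ q ∂(extVol Ω δ)) ^ (1 / q) *
        C ^ (1 / p) ≤ b * (ε / 2) := by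
    have h1 := ((tendsto_ball_integral (δ := δ) hqp hΩb hf hweak hM r).rpow_const
      (p := 1 / q) (Or.inr (by positivity))).mul_const (C ^ (1 / p))
    rw [Real.zero_rpow (one_div_pos.2 hq0).ne', zero_mul] at h1
    exact h1.eventually (Iic_mem_nhds (by positivity))
  filter_upwards [hsmall] with j hj w hw
  have hE := form_self_nonneg hp1 hΩ hhmin hhmax hk hh w
  set E := form Ω δ p k h w w with hEdef
  have h1 := dual_estimate hqp hs hc₀ hΩ hΩb hhmin hhmax hk hh hr0 hrδ (hf j) hw
  have hI0 : 0 ≤ ∫ x in Ω, |f j x| ^ q := integral_nonneg fun _ => by positivity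
  have hW0 : 0 ≤ ∫ x, |w x| ^ p ∂(extVol Ω δ) := integral_nonneg fun _ => by positivity
  have hA0 : 0 ≤ ∫ y, |∫ x in Metric.ball y r, f j x ∂(volume.restrict Ω)| ^ q
      ∂(extVol Ω δ) := integral_nonneg fun _ => by positivity
  have h2 : (b * ∫ x in Ω, |f j x| ^ q) ^ (1 / q) *
      (r ^ ((N : ℝ) + s * p) * (2 / (c₀ * hmin)) * E) ^ (1 / p) ≤ b * (ε / 2) * E ^ (1 / p) := by
    have h3 : r ^ ((N : ℝ) + s * p) * (2 / (c₀ * hmin)) * E =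
        b * (r ^ (s * p) * (2 / (c₀ * hmin) / b₁)) * E := by
      rw [hbdef, hb r hr0, Real.rpow_add hr0]; field_simp
    have h4 : b ^ (1 / q) * b ^ (1 / p) = b := by
      rw [← Real.rpow_add hb0, one_div, one_div, hqp.inv_add_inv_eq_one, Real.rpow_one]
    calc _ ≤ (b * M) ^ (1 / q) *
          (b * (r ^ (s * p) * (2 / (c₀ * hmin) / b₁)) * E) ^ (1 / p) := by
          rw [h3]; gcongr; exact hM j
      _ = (b ^ (1 / q) * b ^ (1 / p)) *
          (M ^ (1 / q) * (r ^ (s * p) * (2 / (c₀ * hmin) / b₁)) ^ (1 / p)) * E ^ (1 / p) := by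
          rw [Real.mul_rpow hb0.le hM0, Real.mul_rpow (by positivity) hE,
            Real.mul_rpow hb0.le (by positivity)]
          ring
      _ ≤ b * (ε / 2) * E ^ (1 / p) := by rw [h4]; gcongr
  have h5 : (∫ y, |∫ x in Metric.ball y r, f j x ∂(volume.restrict Ω)| ^ q
      ∂(extVol Ω δ)) ^ (1 / q) * (∫ x, |w x| ^ p ∂(extVol Ω δ)) ^ (1 / p) ≤
      b * (ε / 2) * E ^ (1 / p) := by
    calc _ ≤ (∫ y, |∫ x in Metric.ball y r, f j x ∂(volume.restrict Ω)| ^ q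
          ∂(extVol Ω δ)) ^ (1 / q) * (C * E) ^ (1 / p) := by gcongr; exact hC w hw
      _ = (∫ y, |∫ x in Metric.ball y r, f j x ∂(volume.restrict Ω)| ^ q
          ∂(extVol Ω δ)) ^ (1 / q) * C ^ (1 / p) * E ^ (1 / p) := by
          rw [Real.mul_rpow hC0 hE, mul_assoc]
      _ ≤ _ := by gcongr
  refine le_of_mul_le_mul_left ?_ hb0
  calc _ ≤ _ := h1
    _ ≤ b * (ε / 2) * E ^ (1 / p) + b * (ε / 2) * E ^ (1 / p) := add_le_add h2 h5
    _ = b * (ε * E ^ (1 / p)) := by ring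

end DualCompactness

/-! ### Completeness, coercivity and uniform convergence of the functionals. -/

section Assembly

variable {N : ℕ} {p q s c₀ δ hmin hmax : ℝ} {Ω : Set (Eucl N)} {k : ℝ → ℝ} {h : Eucl N → ℝ}

lemma exists_mul_rpow_inv_lt {p C η : ℝ} (hp : 0 < p) (hC : 0 ≤ C) (hη : 0 < η) :
    ∃ ε > 0, ∀ t, 0 ≤ t → t ≤ ε → (C * t) ^ (1 / p) < η := by
  -- η/2 makes the final inequality strict; C + 1 allows C = 0.
  refine ⟨(η / 2) ^ p / (C + 1), by positivity, fun t ht0 ht => ?_⟩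
  have h1 : C * t ≤ (η / 2) ^ p := by
    rw [le_div_iff₀ (by positivity)] at ht
    linarith
  calc (C * t) ^ (1 / p) ≤ ((η / 2) ^ p) ^ (1 / p) := by gcongr
    _ = η / 2 := by rw [← Real.rpow_mul (by positivity), mul_one_div_cancel hp.ne', Real.rpow_one]
    _ < η := by linarith

lemma abs_setIntegral_mul_le (hqp : q.HolderConjugate p) {g v : Eucl N → ℝ}
    (hg : MemLp g (ENNReal.ofReal q) (volume.restrict Ω))
    (hv : MemLp v (ENNReal.ofReal p) (extVol Ω δ)) :
    |∫ x in Ω, g x * v x| ≤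
      (∫ x in Ω, |g x| ^ q) ^ (1 / q) * (∫ x, |v x| ^ p ∂(extVol Ω δ)) ^ (1 / p) := by
  have hp0 := hqp.symm.pos
  refine (abs_integral_mul_le_Lp_mul_Lq hqp hg (hv.mono_measure volume_restrict_le_extVol)).trans ?_
  have h1 : ∫ x in Ω, |v x| ^ p ≤ ∫ x, |v x| ^ p ∂(extVol Ω δ) :=
    integral_mono_measure volume_restrict_le_extVol (Eventually.of_forall fun _ => by positivity)
      (MemLp_integrable_abs_rpow hp0 hv)
  have h2 : 0 ≤ ∫ x in Ω, |v x| ^ p := integral_nonneg fun _ => by positivity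
  have h3 : 0 ≤ ∫ x in Ω, |g x| ^ q := integral_nonneg fun _ => by positivity
  gcongr

lemma integrableOn_mul (hqp : q.HolderConjugate p) {g v : Eucl N → ℝ}
    (hg : MemLp g (ENNReal.ofReal q) (volume.restrict Ω)) (hv : v ∈ energySpace Ω δ p k) :
    IntegrableOn (fun x => g x * v x) Ω :=
  integrable_mul_of_holderConjugate hqp hg (hv.1.mono_measure volume_restrict_le_extVol)

lemma setIntegral_mul_sub (hqp : q.HolderConjugate p) {g v w : Eucl N → ℝ}
    (hg : MemLp g (ENNReal.ofReal q) (volume.restrict Ω)) (hv : v ∈ energySpace Ω δ p k)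
    (hw : w ∈ energySpace Ω δ p k) :
    ∫ x in Ω, g x * (v - w) x = (∫ x in Ω, g x * v x) - ∫ x in Ω, g x * w x := by
  rw [← integral_sub (integrableOn_mul hqp hg hv) (integrableOn_mul hqp hg hw)]
  simp only [Pi.sub_apply, mul_sub]

lemma setIntegral_mul_midpoint (hqp : q.HolderConjugate p) {g v w : Eucl N → ℝ}
    (hg : MemLp g (ENNReal.ofReal q) (volume.restrict Ω)) (hv : v ∈ energySpace Ω δ p k)
    (hw : w ∈ energySpace Ω δ p k) :
    ∫ x in Ω, g x * ((1 / 2 : ℝ) • (v + w)) x =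
      ((∫ x in Ω, g x * v x) + ∫ x in Ω, g x * w x) / 2 := by
  rw [← integral_add (integrableOn_mul hqp hg hv) (integrableOn_mul hqp hg hw), ← integral_div]
  refine integral_congr_ae (Eventually.of_forall fun x => ?_)
  simp only [Pi.smul_apply, Pi.add_apply, smul_eq_mul]
  ring

/-- Sequences of competitors that are Cauchy for the energy converge to a competitor. -/
lemma exists_competitor_limit (hN : 0 < N) (hqp : q.HolderConjugate p) (hs : 0 < s)
    (hc₀ : 0 < c₀) (hδ : 0 < δ) (hΩ : IsOpen Ω) (hΩb : Bornology.IsBounded Ω) (hhmin : 0 < hmin)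
    (hhmax : hmin < hmax) (hk : IsKernel N p s c₀ δ k) (hh : IsCoefficient Ω δ hmin hmax h)
    {u₀ g : Eucl N → ℝ} (hg : MemLp g (ENNReal.ofReal q) (volume.restrict Ω))
    {w : ℕ → Eucl N → ℝ} (hw : ∀ n, w n ∈ competitors Ω δ p k u₀)
    (hcau : ∀ ε > 0, ∃ n₀, ∀ m ≥ n₀, ∀ n ≥ n₀, form Ω δ p k h (w m - w n) (w m - w n) ≤ ε) :
    ∃ w' ∈ competitors Ω δ p k u₀,
      (∀ c, (∀ᶠ n in atTop, form Ω δ p k h (w n) (w n) ≤ c) → form Ω δ p k h w' w' ≤ c) ∧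
      Tendsto (fun n => ∫ x in Ω, g x * w n x) atTop (𝓝 (∫ x in Ω, g x * w' x)) := by
  have hp0 := hqp.symm.pos
  have hp1 := hqp.symm.lt
  have hP0 : ENNReal.ofReal p ≠ 0 := (ENNReal.ofReal_pos.2 hp0).ne'
  have : Fact (1 ≤ ENNReal.ofReal p) := ⟨ENNReal.one_le_ofReal.2 hp1.le⟩
  obtain ⟨C, hC0, hC⟩ := exists_poincare hN hp1 hs hc₀ hδ hΩ hΩb hhmin hhmax hk hh
  have hL : ∀ n, MemLp (w n) (ENNReal.ofReal p) (extVol Ω δ) := fun n => (hw n).1.1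
  have hcauchy : CauchySeq fun n => (hL n).toLp (w n) := by
    refine Metric.cauchySeq_iff.2 fun η hη => ?_
    obtain ⟨ε, hε, hη'⟩ := exists_mul_rpow_inv_lt hp0 hC0 hη
    obtain ⟨n₀, hn₀⟩ := hcau ε hε
    refine ⟨n₀, fun m hm n hn => ?_⟩
    have hd := competitors_sub hp1 hk (hw m) (hw n)
    rw [← edist_lt_ofReal, Lp.edist_toLp_toLp, eLpNorm_ofReal_eq hp0 hd.1.1,
      ENNReal.ofReal_lt_ofReal_iff hη]
    refine lt_of_le_of_lt ?_ (hη' _ (form_self_nonneg hp1 hΩ hhmin hhmax hk hh _) (hn₀ m hm n hn))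
    have h0 : 0 ≤ ∫ x, |(w m - w n) x| ^ p ∂(extVol Ω δ) := integral_nonneg fun _ => by positivity
    gcongr
    exact hC _ hd
  obtain ⟨W, hWlim⟩ := cauchySeq_tendsto_of_complete hcauchy
  set w' : Eucl N → ℝ := ⇑W with hw'
  have hw'L : MemLp w' (ENNReal.ofReal p) (extVol Ω δ) := Lp.memLp W
  have hlim : Tendsto (fun n => eLpNorm (w n - w') (ENNReal.ofReal p) (extVol Ω δ)) atTop (𝓝 0) := by
    rw [← Lp.tendsto_Lp_iff_tendsto_eLpNorm'' w hL w' hw'L]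
    simpa only [hw', Lp.toLp_coeFn] using hWlim
  obtain ⟨φ, hφ, hae⟩ := (tendstoInMeasure_of_tendsto_eLpNorm hP0 (fun n => (hL n).1) hw'L.1
    hlim).exists_seq_tendsto_ae
  obtain ⟨n₀, hn₀⟩ := hcau 1 one_pos
  have hd : ∀ n, w n - w n₀ ∈ energySpaceZero Ω δ p k := fun n =>
    competitors_sub hp1 hk (hw n) (hw n₀)
  -- Fatou is applied to w n - w n₀, not to w n: the difference is in X₀, where the weighted energy
  -- controls the unweighted one.
  have hX : w' - w n₀ ∈ energySpace Ω δ p k := by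
    refine ⟨hw'L.sub (hL n₀), ?_⟩
    refine (integrable_formIntegrand_of_ae_tendsto hp1 hk.measurable hk.nonneg
      aemeasurable_const (Eventually.of_forall fun _ => zero_le_one)
      (v := fun j => w (φ j) - w n₀) (fun j => (hd _).1.1.1) (hw'L.sub (hL n₀)).1 ?_
      (fun j => (hd _).1.2) (c := 2 / hmin * 1) ?_).1
    · filter_upwards [hae] with x hx
      exact hx.sub_const _
    · filter_upwards [hφ.tendsto_atTop.eventually_ge_atTop n₀] with j hj
      refine (integral_formIntegrand_one_le hp1 hΩ hhmin hhmax hk hh (hd _)).trans ?_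
      gcongr
      exact hn₀ _ hj _ le_rfl
  have hw'X : w' ∈ energySpace Ω δ p k := by
    simpa using energySpace_linear_combination hp1 hk hX (hw n₀).1 1 1
  have hae' := hae.filter_mono (ae_mono (collarVol_le_extVol (Ω := Ω) (δ := δ)))
  refine ⟨w', ⟨hw'X, ?_⟩, fun c hc => ?_, ?_⟩
  · have hall : ∀ᵐ x ∂(collarVol Ω δ), ∀ n, w n x = u₀ x := ae_all_iff.2 fun n => (hw n).2
    filter_upwards [hae', hall] with x h1 h2
    simp only [h2] at h1
    exact tendsto_nhds_unique h1 tendsto_const_nhds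
  · exact (integrable_formIntegrand_of_ae_tendsto hp1 hk.measurable hk.nonneg
      hh.aemeasurable_prod ((hh.ae_prod hΩ hhmin hhmax).mono fun z hz => hz.1)
      (fun j => (hL (φ j)).1) hw'L.1 hae
      (fun j => integrable_form_self hp1 hΩ hhmin hhmax hk hh (hw _).1)
      (hφ.tendsto_atTop.eventually hc)).2
  · rw [tendsto_iff_norm_sub_tendsto_zero]
    have h1 : Tendsto (fun n => (∫ x in Ω, |g x| ^ q) ^ (1 / q) *
        (eLpNorm (w n - w') (ENNReal.ofReal p) (extVol Ω δ)).toReal) atTop (𝓝 0) := by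
      simpa using ((ENNReal.tendsto_toReal ENNReal.zero_ne_top).comp hlim).const_mul
        ((∫ x in Ω, |g x| ^ q) ^ (1 / q))
    refine squeeze_zero (fun _ => norm_nonneg _) (fun n => ?_) h1
    rw [← setIntegral_mul_sub hqp hg (hw n).1 hw'X, Real.norm_eq_abs,
      eLpNorm_ofReal_eq hp0 ((hL n).sub hw'L), ENNReal.toReal_ofReal (Real.rpow_nonneg
        (integral_nonneg fun _ => by positivity) _)]
    exact abs_setIntegral_mul_le hqp hg ((hL n).sub hw'L)

/-- Coercivity of the Dirichlet functional, uniform on bounded sets of sources. -/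
lemma exists_coercivity_const (hN : 0 < N) (hqp : q.HolderConjugate p) (hs : 0 < s)
    (hc₀ : 0 < c₀) (hδ : 0 < δ) (hΩ : IsOpen Ω) (hΩb : Bornology.IsBounded Ω) (hhmin : 0 < hmin)
    (hhmax : hmin < hmax) (hk : IsKernel N p s c₀ δ k) (hh : IsCoefficient Ω δ hmin hmax h)
    {u₀ b : Eucl N → ℝ} (hb : b ∈ competitors Ω δ p k u₀) {M : ℝ} (hM : 0 ≤ M) :
    ∃ A : ℝ, ∀ g : Eucl N → ℝ, MemLp g (ENNReal.ofReal q) (volume.restrict Ω) →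
      ∫ x in Ω, |g x| ^ q ≤ M → ∀ a ∈ competitors Ω δ p k u₀,
        form Ω δ p k h a a ≤ A + 2 * p * (1 / p * form Ω δ p k h a a - ∫ x in Ω, g x * a x) := by
  have hp0 := hqp.symm.pos
  have hq0 := hqp.pos
  have hp1 := hqp.symm.lt
  obtain ⟨C, hC0, hC⟩ := exists_poincare hN hp1 hs hc₀ hδ hΩ hΩb hhmin hhmax hk hh
  set κ : ℝ := 2 ^ (p - 1) with hκ
  have hκ0 : 0 < κ := by positivity
  -- Chosen so that, after the factor κ from splitting E(a - b), the source term absorbs only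
  -- E(a)/(2p), half of the energy term.
  set η : ℝ := 1 / (2 * p * κ) with hη
  obtain ⟨D, hD0, hD⟩ := exists_mul_rpow_le hp1 (c := M ^ (1 / q) * C ^ (1 / p)) (η := η)
    (by positivity) (by positivity)
  set B : ℝ := M ^ (1 / q) * (∫ x, |b x| ^ p ∂(extVol Ω δ)) ^ (1 / p) with hB
  refine ⟨2 * p * (B + D) + form Ω δ p k h b b, fun g hg hgM a ha => ?_⟩
  have hI0 : 0 ≤ ∫ x in Ω, |g x| ^ q := integral_nonneg fun _ => by positivity
  have hd := competitors_sub hp1 hk ha hb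
  have hE := form_self_nonneg hp1 hΩ hhmin hhmax hk hh (a - b)
  have h1 : ∫ x in Ω, g x * b x ≤ B := by
    refine ((le_abs_self _).trans (abs_setIntegral_mul_le hqp hg hb.1.1)).trans ?_
    have : 0 ≤ ∫ x, |b x| ^ p ∂(extVol Ω δ) := integral_nonneg fun _ => by positivity
    rw [hB]
    gcongr
  have h2 : ∫ x in Ω, g x * (a - b) x ≤ η * form Ω δ p k h (a - b) (a - b) + D := by
    refine ((le_abs_self _).trans (abs_setIntegral_mul_le hqp hg hd.1.1)).trans ?_
    refine le_trans ?_ (hD _ hE)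
    have : 0 ≤ ∫ x, |(a - b) x| ^ p ∂(extVol Ω δ) := integral_nonneg fun _ => by positivity
    rw [mul_assoc, ← Real.mul_rpow hC0 hE]
    gcongr
    exact hC _ hd
  have h3 := form_sub_self_le hp1 hΩ hhmin hhmax hk hh ha.1 hb.1
  have h4 : η * form Ω δ p k h (a - b) (a - b) ≤
      1 / (2 * p) * (form Ω δ p k h a a + form Ω δ p k h b b) := by
    calc _ ≤ η * (κ * (form Ω δ p k h a a + form Ω δ p k h b b)) := by gcongr
      _ = _ := by rw [hη]; field_simp
  rw [setIntegral_mul_sub hqp hg ha.1 hb.1] at h2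
  have h5 : ∫ x in Ω, g x * a x ≤
      B + D + 1 / (2 * p) * (form Ω δ p k h a a + form Ω δ p k h b b) := by linarith
  have h6 := mul_le_mul_of_nonneg_left h5 (by positivity : 0 ≤ 2 * p)
  have h7 : 2 * p * (B + D + 1 / (2 * p) * (form Ω δ p k h a a + form Ω δ p k h b b)) =
      2 * p * (B + D) + form Ω δ p k h a a + form Ω δ p k h b b := by field_simp; ring
  have h8 : 2 * p * (1 / p * form Ω δ p k h a a - ∫ x in Ω, g x * a x) =
      2 * form Ω δ p k h a a - 2 * p * ∫ x in Ω, g x * a x := by field_simp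
  linarith

/-- Split a = b + (a - b): weak convergence handles the fixed b, and dual convergence handles a - b
∈ X₀, whose energy is bounded through R. -/
lemma eventually_abs_sub_le (hN : 0 < N) (hqp : q.HolderConjugate p) (hs : 0 < s)
    (hc₀ : 0 < c₀) (hδ : 0 < δ) (hΩ : IsOpen Ω) (hΩb : Bornology.IsBounded Ω) (hhmin : 0 < hmin)
    (hhmax : hmin < hmax) (hk : IsKernel N p s c₀ δ k) (hh : IsCoefficient Ω δ hmin hmax h)
    {u₀ b : Eucl N → ℝ} (hb : b ∈ competitors Ω δ p k u₀)
    {g : ℕ → Eucl N → ℝ} {g' : Eucl N → ℝ}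
    (hg : ∀ j, MemLp (g j) (ENNReal.ofReal q) (volume.restrict Ω))
    (hg' : MemLp g' (ENNReal.ofReal q) (volume.restrict Ω)) (hgg' : WeaklyConverges Ω p g g')
    (R : ℝ) {ε : ℝ} (hε : 0 < ε) :
    ∀ᶠ j in atTop, ∀ a ∈ competitors Ω δ p k u₀, form Ω δ p k h a a ≤ R →
      |(∫ x in Ω, g j x * a x) - ∫ x in Ω, g' x * a x| ≤ ε := by
  have hp0 := hqp.symm.pos
  have hp1 := hqp.symm.lt
  have hsub : ∀ (j : ℕ) (φ : Eucl N → ℝ), MemLp φ (ENNReal.ofReal p) (volume.restrict Ω) →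
      ∫ x in Ω, (g j - g') x * φ x = (∫ x in Ω, g j x * φ x) - ∫ x in Ω, g' x * φ x := by
    intro j φ hφ
    rw [← integral_sub (integrable_mul_of_holderConjugate hqp (hg j) hφ)
      (integrable_mul_of_holderConjugate hqp hg' hφ)]
    simp only [Pi.sub_apply, sub_mul]
  have hweak : WeaklyConverges Ω p (fun j => g j - g') 0 := fun φ hφ => by
    simp only [hsub _ φ hφ, Pi.zero_apply, zero_mul, integral_zero]
    exact tendsto_sub_nhds_zero_iff.2 (hgg' φ hφ)
  have hbΩ : MemLp b (ENNReal.ofReal p) (volume.restrict Ω) :=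
    hb.1.1.mono_measure volume_restrict_le_extVol
  have hEb := form_self_nonneg hp1 hΩ hhmin hhmax hk hh b
  set T : ℝ := (2 ^ (p - 1) * (|R| + form Ω δ p k h b b)) ^ (1 / p) with hT
  have hT0 : 0 ≤ T := by positivity
  have hb0 : ∀ᶠ j in atTop, |∫ x in Ω, (g j - g') x * b x| ≤ ε / 2 := by
    have h1 := (hweak b hbΩ).abs
    simp only [Pi.zero_apply, zero_mul, integral_zero, abs_zero] at h1
    exact h1.eventually (Iic_mem_nhds (half_pos hε))
  filter_upwards [hb0, eventually_abs_integral_mul_le hN hqp hs hc₀ hδ hΩ hΩb hhmin hhmax hk hh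
    (fun j => (hg j).sub hg') hweak (ε := ε / (2 * (T + 1))) (by positivity)] with j h1 h2 a ha haR
  have hd := competitors_sub hp1 hk ha hb
  have hE := form_self_nonneg hp1 hΩ hhmin hhmax hk hh (a - b)
  have h3 := h2 _ hd
  have h4 : form Ω δ p k h (a - b) (a - b) ^ (1 / p) ≤ T := by
    rw [hT]
    gcongr
    refine (form_sub_self_le hp1 hΩ hhmin hhmax hk hh ha.1 hb.1).trans ?_
    gcongr
    exact haR.trans (le_abs_self R)
  rw [setIntegral_mul_sub hqp ((hg j).sub hg') ha.1 hb.1] at h3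
  rw [← hsub j a (ha.1.1.mono_measure volume_restrict_le_extVol)]
  have h5 : ε / (2 * (T + 1)) * form Ω δ p k h (a - b) (a - b) ^ (1 / p) ≤
      ε / (2 * (T + 1)) * (T + 1) := by gcongr; linarith
  have h6 : ε / (2 * (T + 1)) * (T + 1) = ε / 2 := by field_simp
  have h7 := abs_le.1 h1
  have h8 := abs_le.1 (h3.trans (h5.trans_eq h6))
  exact abs_le.2 ⟨by linarith, by linarith⟩

lemma stronglyConverges_of_energy (hN : 0 < N) (hp : 1 < p) (hs : 0 < s)
    (hc₀ : 0 < c₀) (hδ : 0 < δ) (hΩ : IsOpen Ω) (hΩb : Bornology.IsBounded Ω) (hhmin : 0 < hmin)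
    (hhmax : hmin < hmax) (hk : IsKernel N p s c₀ δ k) (hh : IsCoefficient Ω δ hmin hmax h)
    {U : ℕ → Eucl N → ℝ} {u : Eucl N → ℝ} (hU : ∀ j, U j - u ∈ energySpaceZero Ω δ p k)
    (hE : ∀ ε > 0, ∀ᶠ j in atTop, form Ω δ p k h (U j - u) (U j - u) ≤ ε) :
    StronglyConverges Ω δ p U u := by
  have hp0 : 0 < p := by linarith
  obtain ⟨C, hC0, hC⟩ := exists_poincare hN hp hs hc₀ hδ hΩ hΩb hhmin hhmax hk hh
  refine ENNReal.tendsto_nhds_zero.2 fun e he => ?_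
  obtain ⟨η, hη, hηe⟩ : ∃ η : ℝ, 0 < η ∧ ENNReal.ofReal η ≤ e := by
    rcases eq_or_ne e ⊤ with rfl | htop
    · exact ⟨1, one_pos, le_top⟩
    · exact ⟨e.toReal, ENNReal.toReal_pos he.ne' htop, ENNReal.ofReal_toReal_le⟩
  obtain ⟨ε, hε, hε'⟩ := exists_mul_rpow_inv_lt hp0 hC0 hη
  filter_upwards [hE ε hε] with j hj
  rw [eLpNorm_ofReal_eq hp0 (hU j).1.1]
  refine le_trans (ENNReal.ofReal_le_ofReal ?_) hηe
  refine le_trans ?_ (hε' _ (form_self_nonneg hp hΩ hhmin hhmax hk hh _) hj).le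
  have h0 : 0 ≤ ∫ x, |(U j - u) x| ^ p ∂(extVol Ω δ) := integral_nonneg fun _ => by positivity
  gcongr
  exact hC _ (hU j)

end Assembly

end NonlocalDirichlet

/-! ### Convergence of minima and of states. -/

theorem mainTheorem5 (N : ℕ) (p s c₀ δ hmin hmax : ℝ)
    (hp : 1 < p) (hs : s ∈ Set.Ioo (0 : ℝ) 1) (hps : p * s < N) (hc₀ : 0 < c₀) (hδ : 0 < δ)
    (hhmin : 0 < hmin) (hhmax : hmin < hmax)
    (Ω : Set (NonlocalDirichlet.Eucl N)) (hΩ : IsOpen Ω) (hΩb : Bornology.IsBounded Ω)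
    (k : ℝ → ℝ) (hk : NonlocalDirichlet.IsKernel N p s c₀ δ k)
    (h : NonlocalDirichlet.Eucl N → ℝ)
    (hh : NonlocalDirichlet.IsCoefficient Ω δ hmin hmax h)
    (u₀ : NonlocalDirichlet.Eucl N → ℝ) (hu₀ : u₀ ∈ NonlocalDirichlet.traceSpace Ω δ p k)
    (g : ℕ → NonlocalDirichlet.Eucl N → ℝ) (g' : NonlocalDirichlet.Eucl N → ℝ)
    (hg : ∀ j, MemLp (g j) (ENNReal.ofReal (p / (p - 1))) (volume.restrict Ω))
    (hg' : MemLp g' (ENNReal.ofReal (p / (p - 1))) (volume.restrict Ω))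
    (hgg' : NonlocalDirichlet.WeaklyConverges Ω p g g') :
    (∃ (m : ℕ → ℝ) (m' : ℝ),
      (∀ j, IsLeast (NonlocalDirichlet.dirichletFunctional Ω δ p k h (g j) ''
        NonlocalDirichlet.competitors Ω δ p k u₀) (m j)) ∧
      IsLeast (NonlocalDirichlet.dirichletFunctional Ω δ p k h g' ''
        NonlocalDirichlet.competitors Ω δ p k u₀) m' ∧
      Tendsto m atTop (𝓝 m')) ∧
    (∀ (U : ℕ → NonlocalDirichlet.Eucl N → ℝ) (u : NonlocalDirichlet.Eucl N → ℝ),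
      (∀ j, NonlocalDirichlet.IsState Ω δ p k h u₀ (g j) (U j)) →
      NonlocalDirichlet.IsState Ω δ p k h u₀ g' u →
        NonlocalDirichlet.StronglyConverges Ω δ p U u ∧
        ∀ (φ : ℕ → ℕ) (uStar : NonlocalDirichlet.Eucl N → ℝ), StrictMono φ →
          MemLp uStar (ENNReal.ofReal p) (NonlocalDirichlet.extVol Ω δ) →
          NonlocalDirichlet.StronglyConverges Ω δ p (fun j => U (φ j)) uStar →
          uStar =ᵐ[NonlocalDirichlet.extVol Ω δ] u) := by

  have hN : 0 < N := by
    have h1 : 0 < p * s := mul_pos (by linarith) hs.1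
    exact_mod_cast h1.trans hps
  have hp0 : 0 < p := by linarith
  have hqp : (p / (p - 1)).HolderConjugate p := (Real.HolderConjugate.conjExponent hp).symm
  obtain ⟨b, hbX, hb⟩ := hu₀
  have hbK : b ∈ NonlocalDirichlet.competitors Ω δ p k u₀ := ⟨hbX, hb⟩
  have hmid := fun a (ha : a ∈ NonlocalDirichlet.competitors Ω δ p k u₀) c
    (hc : c ∈ NonlocalDirichlet.competitors Ω δ p k u₀) =>
    NonlocalDirichlet.competitors_midpoint hp hk ha hc
  have hLmid : ∀ f, MemLp f (ENNReal.ofReal (p / (p - 1))) (volume.restrict Ω) →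
      ∀ a ∈ NonlocalDirichlet.competitors Ω δ p k u₀,
      ∀ c ∈ NonlocalDirichlet.competitors Ω δ p k u₀,
      ∫ x in Ω, f x * ((1 / 2 : ℝ) • (a + c)) x =
        ((∫ x in Ω, f x * a x) + ∫ x in Ω, f x * c x) / 2 := fun f hf a ha c hc =>
    NonlocalDirichlet.setIntegral_mul_midpoint hqp hf ha.1 hc.1
  have hgap : ∀ ε > 0, ∃ C : ℝ, 0 ≤ C ∧ ∀ a ∈ NonlocalDirichlet.competitors Ω δ p k u₀,
      ∀ c ∈ NonlocalDirichlet.competitors Ω δ p k u₀,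
      NonlocalDirichlet.form Ω δ p k h (a - c) (a - c) ≤
        ε * (NonlocalDirichlet.form Ω δ p k h a a + NonlocalDirichlet.form Ω δ p k h c c) +
        C * ((NonlocalDirichlet.form Ω δ p k h a a + NonlocalDirichlet.form Ω δ p k h c c) / 2 -
          NonlocalDirichlet.form Ω δ p k h ((1 / 2 : ℝ) • (a + c)) ((1 / 2 : ℝ) • (a + c))) := by
    intro ε hε
    obtain ⟨C, hC, hgap⟩ := NonlocalDirichlet.form_convexity_gap hp hΩ hhmin hhmax hk hh hε
    exact ⟨C, hC, fun a ha c hc => hgap a ha.1 c hc.1⟩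
  have hmin' : ∀ f, MemLp f (ENNReal.ofReal (p / (p - 1))) (volume.restrict Ω) →
      ∃ w ∈ NonlocalDirichlet.competitors Ω δ p k u₀,
        ∀ a ∈ NonlocalDirichlet.competitors Ω δ p k u₀,
          NonlocalDirichlet.dirichletFunctional Ω δ p k h f w ≤
            NonlocalDirichlet.dirichletFunctional Ω δ p k h f a := by
    intro f hf
    obtain ⟨A, hA⟩ := NonlocalDirichlet.exists_coercivity_const hN hqp hs.1 hc₀ hδ hΩ hΩb hhmin
      hhmax hk hh hbK (M := ∫ x in Ω, |f x| ^ (p / (p - 1)))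
      (integral_nonneg fun _ => by positivity)
    exact NonlocalDirichlet.exists_minimizer ⟨b, hbK⟩ hp0 hmid (hLmid f hf) hgap
      (fun a _ => NonlocalDirichlet.form_self_nonneg hp hΩ hhmin hhmax hk hh a) (hA f hf le_rfl)
      fun w hw hcau => NonlocalDirichlet.exists_competitor_limit hN hqp hs.1 hc₀ hδ hΩ hΩb hhmin
        hhmax hk hh hf hw hcau
  -- Weak convergence bounds the g_j in L^{p'}, so a single coercivity constant A serves all j.
  obtain ⟨M, hM0, hM⟩ := NonlocalDirichlet.exists_integral_abs_rpow_le hqp hg fun φ hφ => by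
    obtain ⟨C, hC⟩ := (hgg' φ hφ).abs.bddAbove_range
    exact ⟨C, fun j => hC (mem_range_self j)⟩
  obtain ⟨A, hA⟩ := NonlocalDirichlet.exists_coercivity_const hN hqp hs.1 hc₀ hδ hΩ hΩb hhmin
    hhmax hk hh hbK hM0
  -- Kept general in W and w: applied to chosen minimizers for the values, and to the given states
  -- for their convergence.
  have hstab := fun (W : ℕ → NonlocalDirichlet.Eucl N → ℝ) (w : NonlocalDirichlet.Eucl N → ℝ)
      (hW : ∀ j, W j ∈ NonlocalDirichlet.competitors Ω δ p k u₀)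
      (hw : w ∈ NonlocalDirichlet.competitors Ω δ p k u₀) =>
    NonlocalDirichlet.tendsto_min_and_energy_sub hp0 hmid hgap
      (Lj := fun j a => ∫ x in Ω, g j x * a x) (hLmid g' hg') (fun j => hA _ (hg j) (hM j))
      (fun R ε hε => NonlocalDirichlet.eventually_abs_sub_le hN hqp hs.1 hc₀ hδ hΩ hΩb hhmin
        hhmax hk hh hbK hg hg' hgg' R hε) (W := W) (w := w) hW hw
  constructor
  · choose W hW hWmin using fun j => hmin' (g j) (hg j)
    obtain ⟨w, hw, hwmin⟩ := hmin' g' hg'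
    refine ⟨_, _, fun j => ⟨⟨W j, hW j, rfl⟩, ?_⟩, ⟨⟨w, hw, rfl⟩, ?_⟩,
      (hstab W w hW hw hWmin hwmin).1⟩
    · rintro _ ⟨a, ha, rfl⟩
      exact hWmin j a ha
    · rintro _ ⟨a, ha, rfl⟩
      exact hwmin a ha
  · intro U u hU hu
    have hle : ∀ f, MemLp f (ENNReal.ofReal (p / (p - 1))) (volume.restrict Ω) →
        ∀ v, NonlocalDirichlet.IsState Ω δ p k h u₀ f v →
        ∀ a ∈ NonlocalDirichlet.competitors Ω δ p k u₀,
          NonlocalDirichlet.dirichletFunctional Ω δ p k h f v ≤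
            NonlocalDirichlet.dirichletFunctional Ω δ p k h f a := fun f hf v hv a ha =>
      hv.dirichletFunctional_le hp hΩ hhmin hhmax hk hh ha
        (NonlocalDirichlet.integrableOn_mul hqp hf hv.1.1)
        (NonlocalDirichlet.integrableOn_mul hqp hf ha.1)
    have hconv : NonlocalDirichlet.StronglyConverges Ω δ p U u :=
      NonlocalDirichlet.stronglyConverges_of_energy hN hp hs.1 hc₀ hδ hΩ hΩb hhmin hhmax hk hh
        (fun j => NonlocalDirichlet.competitors_sub hp hk (hU j).1 hu.1)
        (hstab U u (fun j => (hU j).1) hu.1 (fun j => hle _ (hg j) _ (hU j))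
          (hle g' hg' u hu)).2
    refine ⟨hconv, fun φ uStar hφ huStar hlim => ?_⟩
    have hP0 : ENNReal.ofReal p ≠ 0 := (ENNReal.ofReal_pos.2 hp0).ne'
    have hm : ∀ j, AEStronglyMeasurable (U (φ j)) (NonlocalDirichlet.extVol Ω δ) := fun j =>
      (hU (φ j)).1.1.1.1
    -- Both L^p limits of the subsequence are limits in measure, hence equal almost everywhere.
    exact tendstoInMeasure_ae_unique
      (tendstoInMeasure_of_tendsto_eLpNorm hP0 hm huStar.1 hlim)
      (tendstoInMeasure_of_tendsto_eLpNorm hP0 hm hu.1.1.1.1 (hconv.comp hφ.tendsto_atTop))
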